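/- Let $n\ge 0$, $m:=n+1$, and let $U\subset\mathbb{R}^{n+1}$ be a (non-empty, connected, open) domain invariant under multiplication by positive numbers. Let $h:U\to\mathbb{R}^{>0}$ be smooth and homogeneous of degree $D\in\mathbb{R}^{>0}\setminus\{1\}$, and assume that $-\partial^2h$ restricts to a Riemannian metric on the hypersurface $\{x\in U: h(x)=1\}$. Let $M:=\mathbb{R}^{n+1}+iU\subset\mathbb{C}^{n+1}$, with holomorphic coordinates $z^\mu=y^\mu+ix^\mu$, and $$g_M=2\,g_{\mu\bar\nu}\,dz^\mu d\bar z^\nu,\qquad g_{\mu\bar\nu}=\frac{\partial^2K}{\partial z^\mu\partial\bar z^\nu},\qquad K=-\log h(x),$$ where $dz^\mu d\bar z^\nu=\tfrac12(dz^\mu\otimes d\bar z^\nu+d\bar z^\nu\otimes dz^\mu)$. Write $h_\mu=\partial h/\partial x^\mu$, $h_{\mu\nu}=\partial^2h/\partial x^\mu\partial x^\nu$, and so on. Repeated indices are summed, and indices of the derivatives of $h$ are raised with the inverse of the matrix $(-h_{\mu\nu})$, so that, for instance, $h^\rho{}_{\sigma\mu\nu}=\sum_\kappa\big((-\partial^2h)^{-1}\big)^{\rho\kappa}h_{\kappa\sigma\mu\nu}$.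 Let $R(X,Y)Z=\nabla_X\nabla_YZ-\nabla_Y\nabla_XZ-\nabla_{[X,Y]}Z$ be the curvature of the Levi-Civita connection of $g_M$, extended complex multilinearly, with components $R^\rho{}_{\sigma\mu\bar\nu}=dz^\rho\big(R(\partial_{z^\mu},\partial_{\bar z^\nu})\partial_{z^\sigma}\big)$. Let $Ric(Y,Z)=\operatorname{tr}(X\mapsto R(X,Y)Z)$, with $Ric_{\mu\bar\nu}=Ric(\partial_{z^\mu},\partial_{\bar z^\nu})$, and let $scal$ be one half of the trace of $Ric$ with respect to $g_M$. Then $\partial^2h$ is nondegenerate on $U$, $g_M$ is positive definite, and at every point $z=y+ix$ of $M$, all functions on the right-hand sides being evaluated at $x$, $$\begin{aligned}R^\rho{}_{\sigma\mu\bar\nu}=-\frac1{4h^2}\Big[&-h^2h^\rho{}_{\sigma\mu\nu}+\frac1{D-1}x^\rho\,(h\,h_{\sigma\mu\nu}-h_{\mu\sigma}h_\nu)+h_\mu h_\nu\delta^\rho_\sigma+h_\sigma h_\nu\delta^\rho_\mu\\&-h\Big(h_{\sigma\nu}\delta^\rho_\mu+h_{\mu\nu}\delta^\rho_\sigma-\frac1{D-1}h_{\mu\sigma}\delta^\rho_\nu\Big)-h^2h^\rho{}_{\nu\beta}h^\beta{}_{\sigma\mu}\Big],\end{aligned}$$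 $$Ric_{\mu\bar\nu}=-m\,g_{\mu\bar\nu}+\frac14h_\mu{}^{\alpha\beta}h_{\alpha\beta\nu}+\frac14h^\rho{}_{\rho\mu\nu},$$ $$scal=g^{\mu\bar\nu}Ric_{\mu\bar\nu}=-m^2+\frac{D-2}{D-1}\,m+h\,h_{\alpha\beta\gamma}h^{\alpha\beta\gamma}+h\,h^{\mu\nu}{}_{\mu\nu},$$ where $g^{\mu\bar\nu}$ denotes the inverse of the matrix $(g_{\mu\bar\nu})$. -/

import Mathlib

open scoped ContDiff

noncomputable section

namespace RMap

/-! ### Real coordinates and complexified frames on `ℂ^m`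

The real coordinates on `ℂ^m` are `(y, x)` with `z = y + i x`. They are indexed by `Fin m ⊕ Fin m`:
`Sum.inl μ` stands for `y^μ = Re z^μ` and `Sum.inr μ` stands for `x^μ = Im z^μ`. -/

/-- The real coordinate vectors: `∂/∂y^μ` is the `μ`-th unit vector, `∂/∂x^μ` is `i` times it. -/
def coordVec {m : ℕ} : Fin m ⊕ Fin m → (Fin m → ℂ)
  | Sum.inl μ => Pi.single μ 1
  | Sum.inr μ => Pi.single μ Complex.I

/-- The partial derivative of a real function with respect to the `i`-th real coordinate. -/
def realPartial {m : ℕ} (i : Fin m ⊕ Fin m) (f : (Fin m → ℂ) → ℝ) (z : Fin m → ℂ) : ℝ :=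
  fderiv ℝ f z (coordVec i)

/-- The components of `dz^ρ = dy^ρ + i dx^ρ` in the real coordinate coframe. -/
def dz {m : ℕ} (ρ : Fin m) : Fin m ⊕ Fin m → ℂ
  | Sum.inl μ => if μ = ρ then 1 else 0
  | Sum.inr μ => if μ = ρ then Complex.I else 0

/-- The components of the complex tangent vector `∂/∂z^μ = (∂/∂y^μ - i ∂/∂x^μ) / 2` in the real
coordinate frame. -/
def delZ {m : ℕ} (μ : Fin m) : Fin m ⊕ Fin m → ℂ
  | Sum.inl κ => if κ = μ then 1 / 2 else 0
  | Sum.inr κ => if κ = μ then -Complex.I / 2 else 0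

/-- The components of `∂/∂z̄^ν = (∂/∂y^ν + i ∂/∂x^ν) / 2` in the real coordinate frame. -/
def delZbar {m : ℕ} (ν : Fin m) : Fin m ⊕ Fin m → ℂ
  | Sum.inl κ => if κ = ν then 1 / 2 else 0
  | Sum.inr κ => if κ = ν then Complex.I / 2 else 0

/-- The derivative of a complex valued function along a complex tangent vector. -/
def complexDeriv {m : ℕ} (a : Fin m ⊕ Fin m → ℂ) (f : (Fin m → ℂ) → ℂ) (z : Fin m → ℂ) : ℂ :=
  ∑ i, a i * fderiv ℝ f z (coordVec i)

/-! ### Levi-Civita connection and curvature of a metric in real coordinates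

`G z i j` are the components of a metric in the real coordinates. -/

/-- The Christoffel symbols `Γ^k_{ij}` of the Levi-Civita connection. -/
def christoffel {m : ℕ} (G : (Fin m → ℂ) → Matrix (Fin m ⊕ Fin m) (Fin m ⊕ Fin m) ℝ)
    (k i j : Fin m ⊕ Fin m) (z : Fin m → ℂ) : ℝ :=
  (1 / 2) * ∑ l, (G z)⁻¹ k l *
    (realPartial i (fun w => G w j l) z + realPartial j (fun w => G w i l) z
      - realPartial l (fun w => G w i j) z)

/-- The components `R^l_{kij}` of the Riemann tensor: `R(∂_i, ∂_j) ∂_k = ∑ l, R^l_{kij} ∂_l` with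
`R(X, Y) Z = ∇_X ∇_Y Z - ∇_Y ∇_X Z - ∇_{[X, Y]} Z`. -/
def riemann {m : ℕ} (G : (Fin m → ℂ) → Matrix (Fin m ⊕ Fin m) (Fin m ⊕ Fin m) ℝ)
    (l k i j : Fin m ⊕ Fin m) (z : Fin m → ℂ) : ℝ :=
  realPartial i (christoffel G l j k) z - realPartial j (christoffel G l i k) z
    + ∑ s, (christoffel G l i s z * christoffel G s j k z
      - christoffel G l j s z * christoffel G s i k z)

/-- The Ricci tensor `Ric(Y, Z) = tr (X ↦ R(X, Y) Z)`; here `Y = ∂_j` and `Z = ∂_k`. -/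
def ricci {m : ℕ} (G : (Fin m → ℂ) → Matrix (Fin m ⊕ Fin m) (Fin m ⊕ Fin m) ℝ)
    (j k : Fin m ⊕ Fin m) (z : Fin m → ℂ) : ℝ :=
  ∑ l, riemann G l k l j z

/-- The scalar curvature in the normalization used for Kähler metrics: one half of the trace of the
Ricci tensor. -/
def scal {m : ℕ} (G : (Fin m → ℂ) → Matrix (Fin m ⊕ Fin m) (Fin m ⊕ Fin m) ℝ)
    (z : Fin m → ℂ) : ℝ :=
  (1 / 2) * ∑ i, ∑ j, (G z)⁻¹ i j * ricci G i j z

/-- `R^ρ_{σμν̄} = dz^ρ (R(∂/∂z^μ, ∂/∂z̄^ν) ∂/∂z^σ)`, the Riemann tensor being extended complex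
multilinearly. -/
def riemannZ {m : ℕ} (G : (Fin m → ℂ) → Matrix (Fin m ⊕ Fin m) (Fin m ⊕ Fin m) ℝ)
    (ρ σ μ ν : Fin m) (z : Fin m → ℂ) : ℂ :=
  ∑ l, ∑ k, ∑ i, ∑ j,
    dz ρ l * delZ σ k * delZ μ i * delZbar ν j * (riemann G l k i j z : ℂ)

/-- `Ric_{μν̄} = Ric(∂/∂z^μ, ∂/∂z̄^ν)`, the Ricci tensor being extended complex bilinearly. -/
def ricciZ {m : ℕ} (G : (Fin m → ℂ) → Matrix (Fin m ⊕ Fin m) (Fin m ⊕ Fin m) ℝ)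
    (μ ν : Fin m) (z : Fin m → ℂ) : ℂ :=
  ∑ i, ∑ j, delZ μ i * delZbar ν j * (ricci G i j z : ℂ)

/-! ### The Kähler metric of a potential -/

/-- The Hermitian matrix `g_{μν̄} = ∂²K / ∂z^μ ∂z̄^ν` of a real potential `K`. -/
def kahlerCoeff {m : ℕ} (K : (Fin m → ℂ) → ℝ) (z : Fin m → ℂ) : Matrix (Fin m) (Fin m) ℂ :=
  Matrix.of fun μ ν =>
    complexDeriv (delZ μ) (complexDeriv (delZbar ν) (fun w => (K w : ℂ))) z

/-- The real components of the metric `g = 2 ∑ g_{μν̄} dz^μ dz̄^ν`, where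
`dz^μ dz̄^ν = (dz^μ ⊗ dz̄^ν + dz̄^ν ⊗ dz^μ) / 2` is the symmetric product. The sum is real because
`g_{μν̄}` is Hermitian. -/
def kahlerMetric {m : ℕ} (K : (Fin m → ℂ) → ℝ) (z : Fin m → ℂ) :
    Matrix (Fin m ⊕ Fin m) (Fin m ⊕ Fin m) ℝ :=
  Matrix.of fun i j =>
    (∑ μ, ∑ ν, kahlerCoeff K z μ ν *
      (dz μ i * (starRingEnd ℂ) (dz ν j) + (starRingEnd ℂ) (dz ν i) * dz μ j)).re

/-! ### The function `h`, its derivatives and index raising -/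

/-- The partial derivative `∂f/∂x^μ` of a function on `ℝ^m`. -/
def pderiv {m : ℕ} (μ : Fin m) (f : (Fin m → ℝ) → ℝ) (x : Fin m → ℝ) : ℝ :=
  fderiv ℝ f x (Pi.single μ 1)

/-- `h_μ`. -/
def d1 {m : ℕ} (h : (Fin m → ℝ) → ℝ) (μ : Fin m) : (Fin m → ℝ) → ℝ := pderiv μ h

/-- `h_{μν}`. -/
def d2 {m : ℕ} (h : (Fin m → ℝ) → ℝ) (μ ν : Fin m) : (Fin m → ℝ) → ℝ := pderiv μ (d1 h ν)

/-- `h_{μνκ}`. -/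
def d3 {m : ℕ} (h : (Fin m → ℝ) → ℝ) (μ ν κ : Fin m) : (Fin m → ℝ) → ℝ := pderiv μ (d2 h ν κ)

/-- `h_{μνκτ}`. -/
def d4 {m : ℕ} (h : (Fin m → ℝ) → ℝ) (μ ν κ τ : Fin m) : (Fin m → ℝ) → ℝ :=
  pderiv μ (d3 h ν κ τ)

/-- The tensor `-∂²h`, used to raise indices. -/
def negHess {m : ℕ} (h : (Fin m → ℝ) → ℝ) (x : Fin m → ℝ) : Matrix (Fin m) (Fin m) ℝ :=
  Matrix.of fun μ ν => -d2 h μ ν x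

/-- `h^ρ_{νβ}`. -/
def d3Up1 {m : ℕ} (h : (Fin m → ℝ) → ℝ) (ρ ν β : Fin m) (x : Fin m → ℝ) : ℝ :=
  ∑ κ, (negHess h x)⁻¹ ρ κ * d3 h κ ν β x

/-- `h_μ^{αβ}`. -/
def d3Up2 {m : ℕ} (h : (Fin m → ℝ) → ℝ) (μ α β : Fin m) (x : Fin m → ℝ) : ℝ :=
  ∑ κ, ∑ τ, (negHess h x)⁻¹ α κ * (negHess h x)⁻¹ β τ * d3 h μ κ τ x

/-- `h^{αβγ}`. -/
def d3Up3 {m : ℕ} (h : (Fin m → ℝ) → ℝ) (α β γ : Fin m) (x : Fin m → ℝ) : ℝ :=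
  ∑ κ, ∑ τ, ∑ ε, (negHess h x)⁻¹ α κ * (negHess h x)⁻¹ β τ * (negHess h x)⁻¹ γ ε * d3 h κ τ ε x

/-- `h^ρ_{σμν}`. -/
def d4Up1 {m : ℕ} (h : (Fin m → ℝ) → ℝ) (ρ σ μ ν : Fin m) (x : Fin m → ℝ) : ℝ :=
  ∑ κ, (negHess h x)⁻¹ ρ κ * d4 h κ σ μ ν x

/-- `h^{αβ}_{μν}`. -/
def d4Up2 {m : ℕ} (h : (Fin m → ℝ) → ℝ) (α β μ ν : Fin m) (x : Fin m → ℝ) : ℝ :=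
  ∑ κ, ∑ τ, (negHess h x)⁻¹ α κ * (negHess h x)⁻¹ β τ * d4 h κ τ μ ν x

/-! ### The generalized supergravity r-map -/

/-- The data to which the generalized supergravity r-map applies: a domain `U ⊆ ℝ^m` invariant under
positive scalings and a smooth function `h : U → ℝ_{>0}`, homogeneous of degree `D > 0`, `D ≠ 1`,
such that `-∂²h` restricts to a Riemannian metric on the hypersurface `{x ∈ U | h x = 1}` (whose
tangent space at `x` is the kernel of `dh_x`). Only the values of `h` on `U` matter. -/
structure IsRMapDatum {m : ℕ} (D : ℝ) (U : Set (Fin m → ℝ)) (h : (Fin m → ℝ) → ℝ) : Prop where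
  degree_pos : 0 < D
  degree_ne_one : D ≠ 1
  isOpen : IsOpen U
  isConnected : IsConnected U
  smul_mem : ∀ r : ℝ, 0 < r → ∀ x ∈ U, r • x ∈ U
  smooth : ContDiffOn ℝ ∞ h U
  pos : ∀ x ∈ U, 0 < h x
  homogeneous : ∀ r : ℝ, 0 < r → ∀ x ∈ U, h (r • x) = r ^ D * h x
  tangent_pos : ∀ x ∈ U, h x = 1 → ∀ v : Fin m → ℝ, v ≠ 0 → ∑ μ, d1 h μ x * v μ = 0 →
    0 < ∑ μ, ∑ ν, negHess h x μ ν * v μ * v ν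

/-- The imaginary part `x = Im z` of a point `z = y + i x` of `ℂ^m`. -/
def imPart {m : ℕ} (z : Fin m → ℂ) : Fin m → ℝ := fun μ => (z μ).im

/-- The tube domain `M = ℝ^m + i U`. -/
def tubeDomain {m : ℕ} (U : Set (Fin m → ℝ)) : Set (Fin m → ℂ) := {z | imPart z ∈ U}

/-- The Kähler potential `K(z) = -log h(Im z)`. -/
def potential {m : ℕ} (h : (Fin m → ℝ) → ℝ) (z : Fin m → ℂ) : ℝ := -Real.log (h (imPart z))

/-- The metric `g_M` of the generalized supergravity r-map, in the real coordinates. -/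
def rMapMetric {m : ℕ} (h : (Fin m → ℝ) → ℝ) (z : Fin m → ℂ) :
    Matrix (Fin m ⊕ Fin m) (Fin m ⊕ Fin m) ℝ :=
  kahlerMetric (potential h) z

/-- The Kronecker symbol. -/
def kdelta {m : ℕ} (μ ν : Fin m) : ℝ := if μ = ν then 1 else 0

end RMap

end

open scoped ContDiff

noncomputable section

namespace RMap

/-! ### Partial derivatives, homogeneity and linear systems on an open set of ℝ^m. -/

section RealCalculus

variable {m : ℕ} {U : Set (Fin m → ℝ)} {f g : (Fin m → ℝ) → ℝ} {x : Fin m → ℝ}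

/-! The potential depends on `x` alone, so in the coordinates (y, x) the metric is block diagonal
with both blocks equal to A = ½ ∂²(-log h) (`rMapMetric_eq_fromBlocks`). A is a Hessian metric: ∂A
is totally symmetric, its Christoffel matrices are Γ_i = ½ A⁻¹ ∂_i A, and ∂_i Γ_j - ∂_j Γ_i = -2
[Γ_i, Γ_j]. Hence the curvature of the tube is expressed by ∂Γ alone: R^ρ_{σμν̄} = -½ ∂_ν Γ^ρ_{μσ}
and Ric_{μν̄} = -½ ∂_μ Γ^l_{lν} (`riemannZ_tube`, `ricciZ_tube`, `scal_tube`).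

It remains to compute Γ. Write N = -∂²h. Then 2A = N/h + dh⊗dh/h², and Euler's identity N x = -(D-1)
dh makes this rank one perturbation explicitly invertible (`halfHess_inv_apply`). This gives Γ
(`hessianConn_halfHess`) and, after one more derivative, the Riemann and Ricci tensors. In the
scalar curvature the x⊗x part of A⁻¹ is contracted by Euler's identities for the higher derivatives
of h.

Positivity comes from the splitting into the radial line and ker dh: N is positive on ker dh, the
two are N-orthogonal, and dh⊗dh corrects the radial direction (`halfHess_posDef`). -/

theorem contDiffOn_pderiv (hU : IsOpen U) (hf : ContDiffOn ℝ ∞ f U) (μ : Fin m) :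
    ContDiffOn ℝ ∞ (pderiv μ f) U := by
  have h1 : ContDiffOn ℝ ∞ (fderiv ℝ f) U := hf.fderiv_of_isOpen hU (by simp)
  exact h1.clm_apply contDiffOn_const

theorem differentiableAt_of_contDiffOn (hU : IsOpen U) (hf : ContDiffOn ℝ ∞ f U) (hx : x ∈ U) :
    DifferentiableAt ℝ f x :=
  ((hf.contDiffAt (hU.mem_nhds hx)).differentiableAt (by simp))

theorem pderiv_comm (hU : IsOpen U) (hf : ContDiffOn ℝ ∞ f U) (hx : x ∈ U) (μ ν : Fin m) :
    pderiv μ (pderiv ν f) x = pderiv ν (pderiv μ f) x := by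
  have h1 : ContDiffOn ℝ ∞ (fderiv ℝ f) U := hf.fderiv_of_isOpen hU (by simp)
  have h2 : DifferentiableAt ℝ (fderiv ℝ f) x :=
    (h1.contDiffAt (hU.mem_nhds hx)).differentiableAt (by simp)
  have h3 : IsSymmSndFDerivAt ℝ f x :=
    (hf.contDiffAt (hU.mem_nhds hx)).isSymmSndFDerivAt (by simp; norm_cast)
  have key : ∀ α β : Fin m, pderiv α (pderiv β f) x
      = fderiv ℝ (fderiv ℝ f) x (Pi.single α 1) (Pi.single β 1) := by
    intro α β
    unfold pderiv
    rw [fderiv_clm_apply h2 (differentiableAt_const _)]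
    simp
  rw [key, key, h3]

theorem pderiv_congr (hU : IsOpen U) (hfg : Set.EqOn f g U) (hx : x ∈ U) (μ : Fin m) :
    pderiv μ f x = pderiv μ g x := by
  unfold pderiv
  rw [(hfg.eventuallyEq_of_mem (hU.mem_nhds hx)).fderiv_eq]

theorem pderiv_const (μ : Fin m) (c : ℝ) : pderiv μ (fun _ => c) x = 0 := by
  simp [pderiv]

theorem pderiv_apply (μ ρ : Fin m) : pderiv μ (fun y => y ρ) x = if ρ = μ then 1 else 0 := by
  have : HasFDerivAt (fun y : Fin m → ℝ => y ρ) (ContinuousLinearMap.proj (R := ℝ) ρ) x :=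
    (ContinuousLinearMap.proj (R := ℝ) (φ := fun _ : Fin m => ℝ) ρ).hasFDerivAt
  simp [pderiv, this.fderiv, Pi.single_apply]

theorem pderiv_add (hf : DifferentiableAt ℝ f x) (hg : DifferentiableAt ℝ g x) (μ : Fin m) :
    pderiv μ (fun y => f y + g y) x = pderiv μ f x + pderiv μ g x := by
  simp [pderiv, fderiv_fun_add hf hg]

theorem pderiv_sub (hf : DifferentiableAt ℝ f x) (hg : DifferentiableAt ℝ g x) (μ : Fin m) :
    pderiv μ (fun y => f y - g y) x = pderiv μ f x - pderiv μ g x := by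
  simp [pderiv, fderiv_fun_sub hf hg]

theorem pderiv_neg (μ : Fin m) : pderiv μ (fun y => -f y) x = -pderiv μ f x := by
  simp [pderiv, fderiv_fun_neg]

theorem pderiv_mul (hf : DifferentiableAt ℝ f x) (hg : DifferentiableAt ℝ g x) (μ : Fin m) :
    pderiv μ (fun y => f y * g y) x = pderiv μ f x * g x + f x * pderiv μ g x := by
  simp [pderiv, fderiv_fun_mul hf hg]
  ring

theorem pderiv_const_mul (hf : DifferentiableAt ℝ f x) (c : ℝ) (μ : Fin m) :
    pderiv μ (fun y => c * f y) x = c * pderiv μ f x := by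
  simp [pderiv, fderiv_const_mul hf]

theorem pderiv_inv (hf : DifferentiableAt ℝ f x) (h0 : f x ≠ 0) (μ : Fin m) :
    pderiv μ (fun y => (f y)⁻¹) x = -pderiv μ f x / f x ^ 2 := by
  have := (hasDerivAt_inv h0).comp_hasFDerivAt x hf.hasFDerivAt
  change fderiv ℝ (Inv.inv ∘ f) x _ = _
  simp [this.fderiv, pderiv]
  ring

theorem pderiv_log (hf : DifferentiableAt ℝ f x) (h0 : f x ≠ 0) (μ : Fin m) :
    pderiv μ (fun y => Real.log (f y)) x = pderiv μ f x / f x := by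
  simp [pderiv, (hf.hasFDerivAt.log h0).fderiv]
  ring

theorem pderiv_sum {ι : Type*} (s : Finset ι) {F : ι → (Fin m → ℝ) → ℝ}
    (hF : ∀ i ∈ s, DifferentiableAt ℝ (F i) x) (μ : Fin m) :
    pderiv μ (fun y => ∑ i ∈ s, F i y) x = ∑ i ∈ s, pderiv μ (F i) x := by
  simp [pderiv, fderiv_fun_sum hF]

/-- The derivative of a positively homogeneous function of degree `k` is homogeneous of
degree `k - 1`. -/
theorem pderiv_homogeneous (hU : IsOpen U) (hsm : ∀ r : ℝ, 0 < r → ∀ x ∈ U, r • x ∈ U)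
    (hf : ContDiffOn ℝ ∞ f U) {k : ℝ} (hh : ∀ r : ℝ, 0 < r → ∀ x ∈ U, f (r • x) = r ^ k * f x)
    (μ : Fin m) (r : ℝ) (hr : 0 < r) (x : Fin m → ℝ) (hx : x ∈ U) :
    pderiv μ f (r • x) = r ^ (k - 1) * pderiv μ f x := by
  have h1 : HasFDerivAt (fun y => f (r • y))
      ((fderiv ℝ f (r • x)).comp (r • ContinuousLinearMap.id ℝ (Fin m → ℝ))) x :=
    HasFDerivAt.comp x
      (differentiableAt_of_contDiffOn hU hf (hsm r hr x hx)).hasFDerivAt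
      ((hasFDerivAt_id x).const_smul r)
  have h2 := pderiv_congr hU (fun y hy => hh r hr y hy) hx μ
  rw [pderiv_const_mul (differentiableAt_of_contDiffOn hU hf hx)] at h2
  have h3 : pderiv μ (fun y => f (r • y)) x = r * pderiv μ f (r • x) := by
    simp [pderiv, h1.fderiv]
  rw [h3] at h2
  rw [Real.rpow_sub_one hr.ne']
  field_simp
  linarith

/-- Euler's identity. -/
theorem euler_identity (hU : IsOpen U) (hf : ContDiffOn ℝ ∞ f U) {k : ℝ}
    (hh : ∀ r : ℝ, 0 < r → ∀ x ∈ U, f (r • x) = r ^ k * f x) (hx : x ∈ U) :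
    ∑ μ, x μ * pderiv μ f x = k * f x := by
  have hd := (differentiableAt_of_contDiffOn hU hf hx).hasFDerivAt
  have h1 : HasDerivAt (fun r : ℝ => f (r • x)) (fderiv ℝ f x x) 1 := by
    have h2 : HasDerivAt (fun r : ℝ => r • x) x 1 := by
      simpa using (hasDerivAt_id (1 : ℝ)).smul_const x
    have hd' : HasFDerivAt f (fderiv ℝ f x) ((1 : ℝ) • x) := by simpa using hd
    exact hd'.comp_hasDerivAt 1 h2
  have h3 : HasDerivAt (fun r : ℝ => r ^ k * f x) (k * f x) 1 := by
    have := (Real.hasDerivAt_rpow_const (x := 1) (p := k) (Or.inl one_ne_zero)).mul_const (f x)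
    simpa using this
  have h4 : (fun r : ℝ => f (r • x)) =ᶠ[nhds 1] fun r => r ^ k * f x := by
    filter_upwards [lt_mem_nhds one_pos] with r hr using hh r hr x hx
  have h5 := (h1.congr_of_eventuallyEq h4.symm).unique h3
  rw [← h5]
  conv_rhs => rw [← Finset.univ_sum_single x]
  rw [map_sum, Finset.univ_sum_single x]
  refine Finset.sum_congr rfl fun μ _ => ?_
  have : (Pi.single μ (x μ) : Fin m → ℝ) = x μ • Pi.single μ 1 := by
    rw [← Pi.single_smul]; simp
  rw [this, map_smul]; rfl

theorem differentiableAt_det {ι : Type*} [Fintype ι] [DecidableEq ι]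
    {A : (Fin m → ℝ) → Matrix ι ι ℝ} (hA : ∀ i j, DifferentiableAt ℝ (fun y => A y i j) x) :
    DifferentiableAt ℝ (fun y => (A y).det) x := by
  simp only [Matrix.det_apply]
  refine DifferentiableAt.fun_sum fun σ _ => ?_
  refine DifferentiableAt.const_smul ?_ _
  exact (HasFDerivAt.finsetProd fun i _ => (hA (σ i) i).hasFDerivAt).differentiableAt

theorem differentiableAt_matrix_inv {ι : Type*} [Fintype ι] [DecidableEq ι]
    {A : (Fin m → ℝ) → Matrix ι ι ℝ} (hA : ∀ i j, DifferentiableAt ℝ (fun y => A y i j) x)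
    (h0 : (A x).det ≠ 0) (i j : ι) : DifferentiableAt ℝ (fun y => (A y)⁻¹ i j) x := by
  simp only [Matrix.inv_def, Matrix.smul_apply, Ring.inverse_eq_inv', Matrix.adjugate_apply,
    smul_eq_mul]
  refine ((differentiableAt_det hA).inv h0).mul (differentiableAt_det fun k l => ?_)
  by_cases hk : k = j
  · subst hk; simp
  · simpa [Matrix.updateRow_apply, hk] using hA k l

/-- The derivative of the solution of a linear system. -/
theorem pderiv_inv_mulVec (hU : IsOpen U) (hx : x ∈ U) {ι : Type*} [Fintype ι] [DecidableEq ι]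
    {A : (Fin m → ℝ) → Matrix ι ι ℝ} {b : ι → (Fin m → ℝ) → ℝ}
    (hA : ∀ i j, DifferentiableAt ℝ (fun y => A y i j) x) (hb : ∀ i, DifferentiableAt ℝ (b i) x)
    (h0 : ∀ y ∈ U, (A y).det ≠ 0) (ρ : ι) (ν : Fin m) :
    pderiv ν (fun y => ∑ κ, (A y)⁻¹ ρ κ * b κ y) x =
      ∑ α, (A x)⁻¹ ρ α * (pderiv ν (b α) x
        - ∑ κ, pderiv ν (fun y => A y α κ) x * ∑ τ, (A x)⁻¹ κ τ * b τ x) := by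
  set c : ι → (Fin m → ℝ) → ℝ := fun ρ y => ∑ κ, (A y)⁻¹ ρ κ * b κ y with hc
  have hcd : ∀ ρ, DifferentiableAt ℝ (c ρ) x := fun ρ =>
    DifferentiableAt.fun_sum fun κ _ =>
      (differentiableAt_matrix_inv hA (h0 x hx) ρ κ).mul (hb κ)
  have hvec : ∀ y, (fun ρ => c ρ y) = (A y)⁻¹.mulVec (fun κ => b κ y) := fun y => rfl
  -- With c = A⁻¹ b, differentiating A c = b and solving for ∂c requires no formula for the
  -- derivative of A⁻¹.
  have hsys : ∀ α, Set.EqOn (fun y => ∑ κ, A y α κ * c κ y) (b α) U := by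
    intro α y hy
    have : (A y).mulVec (fun ρ => c ρ y) = fun κ => b κ y := by
      rw [hvec, Matrix.mulVec_mulVec, Matrix.mul_nonsing_inv _ (h0 y hy).isUnit, Matrix.one_mulVec]
    exact congrFun this α
  have hder : ∀ α, ∑ κ, A x α κ * pderiv ν (c κ) x
      = pderiv ν (b α) x - ∑ κ, pderiv ν (fun y => A y α κ) x * c κ x := by
    intro α
    have h1 := pderiv_congr hU (hsys α) hx ν
    rw [pderiv_sum (F := fun κ y => A y α κ * c κ y) _
      (fun κ _ => (hA α κ).mul (hcd κ))] at h1
    simp only [pderiv_mul (hA α _) (hcd _), Finset.sum_add_distrib] at h1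
    linarith
  have h2 : (A x).mulVec (fun κ => pderiv ν (c κ) x)
      = fun α => pderiv ν (b α) x - ∑ κ, pderiv ν (fun y => A y α κ) x * c κ x := funext hder
  have h3 : (A x)⁻¹.mulVec ((A x).mulVec (fun κ => pderiv ν (c κ) x))
      = fun κ => pderiv ν (c κ) x := by
    rw [Matrix.mulVec_mulVec, Matrix.nonsing_inv_mul _ (h0 x hx).isUnit, Matrix.one_mulVec]
  rw [h2] at h3
  exact (congrFun h3 ρ).symm

end RealCalculus

/-! ### Functions on the tube domain that depend only on the imaginary part. -/

section TubeMetric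

variable {m : ℕ} {U : Set (Fin m → ℝ)}

/-- The imaginary part as a continuous linear map. -/
def imPartL (m : ℕ) : (Fin m → ℂ) →L[ℝ] (Fin m → ℝ) :=
  ContinuousLinearMap.pi fun μ => Complex.imCLM.comp (ContinuousLinearMap.proj μ)

theorem imPart_coordVec_inl (μ : Fin m) : imPart (coordVec (Sum.inl μ)) = 0 := by
  ext κ
  by_cases h : κ = μ
  · subst h; simp [imPart, coordVec]
  · simp [imPart, coordVec, h]

theorem imPart_coordVec_inr (μ : Fin m) : imPart (coordVec (Sum.inr μ)) = Pi.single μ 1 := by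
  ext κ
  by_cases h : κ = μ
  · subst h; simp [imPart, coordVec]
  · simp [imPart, coordVec, h]

theorem isOpen_tubeDomain (hU : IsOpen U) : IsOpen (tubeDomain U) :=
  hU.preimage (imPartL m).continuous

theorem hasFDerivAt_comp_imPart {E : Type*} [NormedAddCommGroup E] [NormedSpace ℝ E]
    {f : (Fin m → ℝ) → E} {z : Fin m → ℂ}
    (hf : DifferentiableAt ℝ f (imPart z)) :
    HasFDerivAt (fun w => f (imPart w)) ((fderiv ℝ f (imPart z)).comp (imPartL m)) z :=
  HasFDerivAt.comp z (f := imPart) hf.hasFDerivAt (imPartL m).hasFDerivAt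

variable {F : (Fin m → ℂ) → ℝ} {f : (Fin m → ℝ) → ℝ} {z : Fin m → ℂ}

theorem fderiv_of_eqOn_tube {E : Type*} [NormedAddCommGroup E] [NormedSpace ℝ E]
    {F : (Fin m → ℂ) → E} {f : (Fin m → ℝ) → E} (hU : IsOpen U)
    (hF : ∀ w ∈ tubeDomain U, F w = f (imPart w))
    (hz : z ∈ tubeDomain U) (hf : DifferentiableAt ℝ f (imPart z)) (v : Fin m → ℂ) :
    fderiv ℝ F z v = fderiv ℝ f (imPart z) (imPart v) := by
  have h1 : Set.EqOn F (fun w => f (imPart w)) (tubeDomain U) := hF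
  rw [(h1.eventuallyEq_of_mem ((isOpen_tubeDomain hU).mem_nhds hz)).fderiv_eq,
    (hasFDerivAt_comp_imPart hf).fderiv]
  rfl

theorem realPartial_inl (hU : IsOpen U) (hF : ∀ w ∈ tubeDomain U, F w = f (imPart w))
    (hz : z ∈ tubeDomain U) (hf : DifferentiableAt ℝ f (imPart z)) (μ : Fin m) :
    realPartial (Sum.inl μ) F z = 0 := by
  rw [realPartial, fderiv_of_eqOn_tube hU hF hz hf, imPart_coordVec_inl, map_zero]

theorem realPartial_inr (hU : IsOpen U) (hF : ∀ w ∈ tubeDomain U, F w = f (imPart w))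
    (hz : z ∈ tubeDomain U) (hf : DifferentiableAt ℝ f (imPart z)) (μ : Fin m) :
    realPartial (Sum.inr μ) F z = pderiv μ f (imPart z) := by
  rw [realPartial, fderiv_of_eqOn_tube hU hF hz hf, imPart_coordVec_inr, pderiv]

/-! ### The connection of a Hessian metric. -/

/-- The Christoffel symbols of the Hessian metric with components `A`. -/
def hessianConn (A : (Fin m → ℝ) → Matrix (Fin m) (Fin m) ℝ) (k i j : Fin m) (x : Fin m → ℝ) : ℝ :=
  (1 / 2) * ∑ l, (A x)⁻¹ k l * pderiv i (fun y => A y j l) x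

/-- The components of a metric on a domain `U` are smooth, and they are locally the second
derivatives of a function. -/
structure IsHessianMetric (U : Set (Fin m → ℝ))
    (A : (Fin m → ℝ) → Matrix (Fin m) (Fin m) ℝ) : Prop where
  isOpen : IsOpen U
  smooth : ∀ k l, ContDiffOn ℝ ∞ (fun y => A y k l) U
  det_ne_zero : ∀ y ∈ U, (A y).det ≠ 0
  symm : ∀ y ∈ U, ∀ k l, A y k l = A y l k
  codazzi : ∀ y ∈ U, ∀ i j k, pderiv i (fun w => A w j k) y = pderiv j (fun w => A w i k) y

namespace IsHessianMetric

variable {A : (Fin m → ℝ) → Matrix (Fin m) (Fin m) ℝ} (hA : IsHessianMetric U A)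
  {x : Fin m → ℝ}

include hA

theorem differentiableAt (hx : x ∈ U) (k l : Fin m) :
    DifferentiableAt ℝ (fun y => A y k l) x :=
  differentiableAt_of_contDiffOn hA.isOpen (hA.smooth k l) hx

theorem pderiv_symm (hx : x ∈ U) (i j k : Fin m) :
    pderiv i (fun w => A w j k) x = pderiv i (fun w => A w k j) x :=
  pderiv_congr hA.isOpen (fun y hy => hA.symm y hy j k) hx i

theorem differentiableAt_pderiv (hx : x ∈ U) (i j k : Fin m) :
    DifferentiableAt ℝ (pderiv i fun y => A y j k) x :=
  differentiableAt_of_contDiffOn hA.isOpen (contDiffOn_pderiv hA.isOpen (hA.smooth j k) i) hx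

theorem differentiableAt_conn (hx : x ∈ U) (k i j : Fin m) :
    DifferentiableAt ℝ (hessianConn A k i j) x := by
  unfold hessianConn
  refine DifferentiableAt.const_mul (DifferentiableAt.fun_sum fun l _ => ?_) _
  exact (differentiableAt_matrix_inv (hA.differentiableAt hx) (hA.det_ne_zero x hx) k l).mul
    (hA.differentiableAt_pderiv hx i j l)

/-- In matrix form Γ_i = ½ A⁻¹ ∂_i A. Differentiating A⁻¹ produces -½ (A⁻¹ ∂_ν A)(A⁻¹ ∂_i A), and
each bracket is twice a Christoffel matrix, hence the coefficient 2. -/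
theorem pderiv_conn (hx : x ∈ U) (ν k i j : Fin m) :
    pderiv ν (hessianConn A k i j) x =
      (1 / 2) * ∑ l, (A x)⁻¹ k l * pderiv ν (pderiv i fun y => A y j l) x
        - 2 * ∑ s, hessianConn A k ν s x * hessianConn A s i j x := by
  have h1 : DifferentiableAt ℝ
      (fun y => ∑ l, (A y)⁻¹ k l * pderiv i (fun w => A w j l) y) x := by
    refine DifferentiableAt.fun_sum fun l _ => ?_
    exact (differentiableAt_matrix_inv (hA.differentiableAt hx) (hA.det_ne_zero x hx) k l).mul
      (hA.differentiableAt_pderiv hx i j l)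
  have h2 := pderiv_inv_mulVec (b := fun l y => pderiv i (fun w => A w j l) y) hA.isOpen hx
    (hA.differentiableAt hx) (hA.differentiableAt_pderiv hx i j) hA.det_ne_zero k ν
  have h3 : pderiv ν (hessianConn A k i j) x = (1 / 2) *
      pderiv ν (fun y => ∑ l, (A y)⁻¹ k l * pderiv i (fun w => A w j l) y) x :=
    pderiv_const_mul h1 _ _
  rw [h3, h2]
  have h4 : ∑ s, hessianConn A k ν s x * hessianConn A s i j x = (1 / 4) * ∑ α, (A x)⁻¹ k α *
      ∑ κ, pderiv ν (fun y => A y α κ) x * ∑ τ, (A x)⁻¹ κ τ * pderiv i (fun w => A w j τ) x := by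
    obtain ⟨c, hc⟩ : ∃ c : Fin m → ℝ,
        c = fun κ => ∑ τ, (A x)⁻¹ κ τ * pderiv i (fun w => A w j τ) x := ⟨_, rfl⟩
    have hc1 : ∀ s, hessianConn A s i j x = (1 / 2) * c s := fun s => by rw [hc, hessianConn]
    have hc2 : ∀ s, ∑ τ, (A x)⁻¹ s τ * pderiv i (fun w => A w j τ) x = c s := fun s => by rw [hc]
    have hν : ∀ s, hessianConn A k ν s x
        = (1 / 2) * ∑ l, (A x)⁻¹ k l * pderiv ν (fun y => A y l s) x := fun s => by
      rw [hessianConn, Finset.sum_congr rfl fun l _ => by rw [hA.pderiv_symm hx ν s l]]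
    simp only [hc1, hc2, hν, Finset.mul_sum, Finset.sum_mul]
    rw [Finset.sum_comm]
    refine Finset.sum_congr rfl fun α _ => Finset.sum_congr rfl fun κ _ => ?_
    ring
  rw [h4]
  simp only [mul_sub, Finset.sum_sub_distrib]
  ring

/-- The Codazzi equation expresses the antisymmetrized derivative of the connection through
its square. -/
theorem pderiv_conn_sub (hx : x ∈ U) (i j k l : Fin m) :
    pderiv i (hessianConn A l j k) x - pderiv j (hessianConn A l i k) x =
      -2 * ∑ s, (hessianConn A l i s x * hessianConn A s j k x
        - hessianConn A l j s x * hessianConn A s i k x) := by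
  rw [hA.pderiv_conn hx, hA.pderiv_conn hx, Finset.sum_sub_distrib]
  -- The terms with second derivatives of `A` are symmetric in `i`, `j` and cancel; only the
  -- products of connections survive.
  have : ∀ s, pderiv i (pderiv j fun y => A y k s) x = pderiv j (pderiv i fun y => A y k s) x :=
    fun s => pderiv_comm hA.isOpen (hA.smooth k s) hx i j
  simp only [this]
  ring

end IsHessianMetric

/-! ### Connection and curvature of a tube metric with Hessian blocks. -/

/-- The Christoffel symbols, in the real coordinates of the tube domain, of the metric whose
restriction to the real and to the imaginary directions is the Hessian metric `A`. -/
def tubeConn (A : (Fin m → ℝ) → Matrix (Fin m) (Fin m) ℝ) :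
    Fin m ⊕ Fin m → Fin m ⊕ Fin m → Fin m ⊕ Fin m → (Fin m → ℝ) → ℝ
  | Sum.inr k, Sum.inr i, Sum.inr j => hessianConn A k i j
  | Sum.inr k, Sum.inl i, Sum.inl j => fun y => -hessianConn A k i j y
  | Sum.inl k, Sum.inl i, Sum.inr j => hessianConn A k i j
  | Sum.inl k, Sum.inr i, Sum.inl j => hessianConn A k i j
  | _, _, _ => fun _ => 0

/-- The commutator `[Γ_i, Γ_j]` of the connection matrices. -/
def connComm (A : (Fin m → ℝ) → Matrix (Fin m) (Fin m) ℝ) (l k i j : Fin m) (x : Fin m → ℝ) : ℝ :=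
  ∑ s, (hessianConn A l i s x * hessianConn A s j k x
    - hessianConn A l j s x * hessianConn A s i k x)

/-- The Riemann tensor of a tube metric in the real coordinates. -/
def tubeRiemann (A : (Fin m → ℝ) → Matrix (Fin m) (Fin m) ℝ) :
    Fin m ⊕ Fin m → Fin m ⊕ Fin m → Fin m ⊕ Fin m → Fin m ⊕ Fin m → (Fin m → ℝ) → ℝ
  | Sum.inr l, Sum.inr k, Sum.inr i, Sum.inr j => fun x => -connComm A l k i j x
  | Sum.inl l, Sum.inl k, Sum.inr i, Sum.inr j => fun x => -connComm A l k i j x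
  | Sum.inr l, Sum.inr k, Sum.inl i, Sum.inl j => fun x => -connComm A l k i j x
  | Sum.inl l, Sum.inl k, Sum.inl i, Sum.inl j => fun x => -connComm A l k i j x
  | Sum.inr l, Sum.inl k, Sum.inr i, Sum.inl j => fun x =>
      -pderiv i (hessianConn A l j k) x - connComm A l k i j x
  | Sum.inr l, Sum.inl k, Sum.inl i, Sum.inr j => fun x =>
      pderiv j (hessianConn A l i k) x - connComm A l k i j x
  | Sum.inl l, Sum.inr k, Sum.inr i, Sum.inl j => fun x =>
      pderiv i (hessianConn A l j k) x + connComm A l k i j x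
  | Sum.inl l, Sum.inr k, Sum.inl i, Sum.inr j => fun x =>
      -pderiv j (hessianConn A l i k) x + connComm A l k i j x
  | _, _, _, _ => fun _ => 0

theorem sum_dz_mul (ρ : Fin m) (F : Fin m ⊕ Fin m → ℂ) :
    ∑ i, dz ρ i * F i = F (Sum.inl ρ) + Complex.I * F (Sum.inr ρ) := by
  simp [Fintype.sum_sum_type, dz]

theorem sum_delZ_mul (μ : Fin m) (F : Fin m ⊕ Fin m → ℂ) :
    ∑ i, delZ μ i * F i = (1 / 2) * (F (Sum.inl μ) - Complex.I * F (Sum.inr μ)) := by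
  simp [Fintype.sum_sum_type, delZ]
  ring

theorem sum_delZbar_mul (ν : Fin m) (F : Fin m ⊕ Fin m → ℂ) :
    ∑ i, delZbar ν i * F i = (1 / 2) * (F (Sum.inl ν) + Complex.I * F (Sum.inr ν)) := by
  simp [Fintype.sum_sum_type, delZbar]
  ring

theorem differentiableAt_tubeConn {A : (Fin m → ℝ) → Matrix (Fin m) (Fin m) ℝ}
    (hA : IsHessianMetric U A) {x : Fin m → ℝ} (hx : x ∈ U) (k i j : Fin m ⊕ Fin m) :
    DifferentiableAt ℝ (tubeConn A k i j) x := by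
  rcases k with k | k <;> rcases i with i | i <;> rcases j with j | j <;>
    simp only [tubeConn] <;>
    first
    | exact differentiableAt_const _
    | exact hA.differentiableAt_conn hx _ _ _
    | exact (hA.differentiableAt_conn hx _ _ _).neg

section Curvature

variable {A : (Fin m → ℝ) → Matrix (Fin m) (Fin m) ℝ} (hA : IsHessianMetric U A)
  {G : (Fin m → ℂ) → Matrix (Fin m ⊕ Fin m) (Fin m ⊕ Fin m) ℝ}
  (hG : ∀ w ∈ tubeDomain U, G w = Matrix.fromBlocks (A (imPart w)) 0 0 (A (imPart w)))

include hA hG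

theorem inv_tube (hz : z ∈ tubeDomain U) :
    (G z)⁻¹ = Matrix.fromBlocks (A (imPart z))⁻¹ 0 0 (A (imPart z))⁻¹ := by
  have hu : IsUnit (A (imPart z)).det := (hA.det_ne_zero _ hz).isUnit
  rw [hG z hz]
  refine Matrix.inv_eq_left_inv ?_
  rw [Matrix.fromBlocks_multiply]
  simp [Matrix.nonsing_inv_mul _ hu]

/-- Only x-derivatives of diagonal blocks are nonzero, and ∂A is totally symmetric. With two real
lower indices only the negative term of the Christoffel formula survives, hence the minus sign in
`tubeConn`. -/
theorem christoffel_tube (hz : z ∈ tubeDomain U) (k i j : Fin m ⊕ Fin m) :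
    christoffel G k i j z = tubeConn A k i j (imPart z) := by
  have hx : imPart z ∈ U := hz
  have d0 : ∀ (i : Fin m ⊕ Fin m) (k l : Fin m),
      realPartial i (fun w => G w (Sum.inl k) (Sum.inr l)) z = 0 ∧
      realPartial i (fun w => G w (Sum.inr k) (Sum.inl l)) z = 0 := by
    rintro (i | i) k l
    · exact ⟨realPartial_inl (f := fun _ => 0) hA.isOpen (fun w hw => by simp [hG w hw]) hz
        (differentiableAt_const _) i, realPartial_inl (f := fun _ => 0) hA.isOpen
        (fun w hw => by simp [hG w hw]) hz (differentiableAt_const _) i⟩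
    · rw [realPartial_inr (f := fun _ => 0) hA.isOpen (fun w hw => by simp [hG w hw]) hz
        (differentiableAt_const _) i, realPartial_inr (f := fun _ => 0) hA.isOpen
        (fun w hw => by simp [hG w hw]) hz (differentiableAt_const _) i]
      simp [pderiv_const]
  have d1 : ∀ i k l : Fin m, realPartial (Sum.inl i) (fun w => G w (Sum.inl k) (Sum.inl l)) z = 0 ∧
      realPartial (Sum.inl i) (fun w => G w (Sum.inr k) (Sum.inr l)) z = 0 := fun i k l =>
    ⟨realPartial_inl (f := fun y => A y k l) hA.isOpen (fun w hw => by simp [hG w hw]) hz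
      (hA.differentiableAt hz k l) i, realPartial_inl (f := fun y => A y k l) hA.isOpen
      (fun w hw => by simp [hG w hw]) hz (hA.differentiableAt hz k l) i⟩
  have d2 : ∀ i k l : Fin m,
      realPartial (Sum.inr i) (fun w => G w (Sum.inl k) (Sum.inl l)) z
        = pderiv i (fun y => A y k l) (imPart z) ∧
      realPartial (Sum.inr i) (fun w => G w (Sum.inr k) (Sum.inr l)) z
        = pderiv i (fun y => A y k l) (imPart z) := fun i k l =>
    ⟨realPartial_inr (f := fun y => A y k l) hA.isOpen (fun w hw => by simp [hG w hw]) hz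
      (hA.differentiableAt hz k l) i, realPartial_inr (f := fun y => A y k l) hA.isOpen
      (fun w hw => by simp [hG w hw]) hz (hA.differentiableAt hz k l) i⟩
  have hs : ∀ i j l, pderiv l (fun y => A y i j) (imPart z)
      = pderiv i (fun y => A y j l) (imPart z) := fun i j l => by
    rw [hA.codazzi _ hx l i j, hA.pderiv_symm hx]
  rcases k with k | k <;> rcases i with i | i <;> rcases j with j | j <;>
    simp [christoffel, Fintype.sum_sum_type, inv_tube hA hG hz, d0, d1, d2, tubeConn,
      hessianConn]
  · exact Finset.sum_congr rfl fun l _ => by rw [hA.codazzi _ hx j i l]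
  · exact Finset.sum_congr rfl fun l _ => by rw [hs i j l]
  · exact Finset.sum_congr rfl fun l _ => by rw [hs i j l, hA.codazzi _ hx j i l]; ring

theorem realPartial_christoffel_inl (hz : z ∈ tubeDomain U) (k i j : Fin m ⊕ Fin m) (μ : Fin m) :
    realPartial (Sum.inl μ) (christoffel G k i j) z = 0 :=
  realPartial_inl hA.isOpen (fun _ hw => christoffel_tube hA hG hw k i j) hz
    (differentiableAt_tubeConn hA hz k i j) μ

theorem realPartial_christoffel_inr (hz : z ∈ tubeDomain U) (k i j : Fin m ⊕ Fin m) (μ : Fin m) :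
    realPartial (Sum.inr μ) (christoffel G k i j) z = pderiv μ (tubeConn A k i j) (imPart z) :=
  realPartial_inr hA.isOpen (fun _ hw => christoffel_tube hA hG hw k i j) hz
    (differentiableAt_tubeConn hA hz k i j) μ

/-- If `i`, `j` are both imaginary, the derivative terms are -2 times the commutator and flip its
sign; if both are real, they vanish. In the mixed case exactly one derivative of the connection
remains. -/
theorem riemann_tube (hz : z ∈ tubeDomain U) (l k i j : Fin m ⊕ Fin m) :
    riemann G l k i j z = tubeRiemann A l k i j (imPart z) := by
  have hx : imPart z ∈ U := hz
  rcases l with l | l <;> rcases k with k | k <;> rcases i with i | i <;> rcases j with j | j <;>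
    simp only [riemann, tubeRiemann, connComm, realPartial_christoffel_inl hA hG hz,
      realPartial_christoffel_inr hA hG hz, christoffel_tube hA hG hz, tubeConn,
      Fintype.sum_sum_type, pderiv_neg, pderiv_const, mul_zero, zero_mul, sub_zero, zero_sub,
      Finset.sum_const_zero, zero_add, add_zero, neg_zero, mul_neg, neg_mul,
      Finset.sum_sub_distrib, Finset.sum_neg_distrib, neg_sub, hA.pderiv_conn_sub hx] <;>
    ring

/-- The components of the Ricci tensor of a tube metric in the imaginary directions, which are also
those in the real directions. -/
theorem ricci_tube (hz : z ∈ tubeDomain U) (j k : Fin m) :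
    ricci G (Sum.inl j) (Sum.inl k) z = -∑ l, pderiv j (hessianConn A l l k) (imPart z) ∧
    ricci G (Sum.inr j) (Sum.inr k) z = -∑ l, pderiv j (hessianConn A l l k) (imPart z) ∧
    ricci G (Sum.inl j) (Sum.inr k) z = 0 ∧ ricci G (Sum.inr j) (Sum.inl k) z = 0 := by
  have hx : imPart z ∈ U := hz
  -- In the imaginary directions the two commutators in the trace cancel. In the real directions
  -- they add up, and this identity absorbs them by exchanging the derivative index with a lower
  -- index of the connection.
  have hc : ∀ l, pderiv j (hessianConn A l l k) (imPart z)
      = pderiv l (hessianConn A l j k) (imPart z) + 2 * connComm A l k l j (imPart z) := by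
    intro l
    have := hA.pderiv_conn_sub hx l j k l
    simp only [connComm]
    linarith
  refine ⟨?_, ?_, ?_, ?_⟩ <;>
    simp only [ricci, riemann_tube hA hG hz, Fintype.sum_sum_type, tubeRiemann,
      Finset.sum_const_zero, ← Finset.sum_add_distrib, ← Finset.sum_neg_distrib, hc]
  all_goals refine Finset.sum_congr rfl fun l _ => ?_
  all_goals ring

/-- This is the Kähler identity R^ρ_{σμν̄} = -∂_ν̄ Γ^ρ_{μσ} for the holomorphic Christoffel symbols:
these are -i times `hessianConn`, and ∂_ν̄ acts on functions of x as (i/2) ∂_ν, whence -1/2. The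
proof expands the complex frames after rewriting the commutators as differences of derivatives. -/
theorem riemannZ_tube (hz : z ∈ tubeDomain U) (ρ σ μ ν : Fin m) :
    riemannZ G ρ σ μ ν z = ((-(1 / 2) * pderiv ν (hessianConn A ρ μ σ) (imPart z) : ℝ) : ℂ) := by
  have hx : imPart z ∈ U := hz
  have hc := hA.pderiv_conn_sub hx μ ν σ ρ
  have hc' : connComm A ρ σ μ ν (imPart z) = -(1 / 2) * (pderiv μ (hessianConn A ρ ν σ) (imPart z)
      - pderiv ν (hessianConn A ρ μ σ) (imPart z)) := by
    simp only [connComm]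
    linarith
  simp only [riemannZ, mul_assoc, ← Finset.mul_sum, sum_dz_mul, sum_delZ_mul, sum_delZbar_mul,
    riemann_tube hA hG hz, tubeRiemann, hc']
  push_cast
  ring_nf
  simp only [Complex.I_sq, Complex.I_pow_four]
  ring

theorem ricciZ_tube (hz : z ∈ tubeDomain U) (μ ν : Fin m) :
    ricciZ G μ ν z
      = ((-(1 / 2) * ∑ l, pderiv μ (hessianConn A l l ν) (imPart z) : ℝ) : ℂ) := by
  simp only [ricciZ, mul_assoc, ← Finset.mul_sum, sum_delZ_mul, sum_delZbar_mul,
    ricci_tube hA hG hz]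
  push_cast
  ring_nf
  simp only [Complex.I_sq]
  ring

theorem scal_tube (hz : z ∈ tubeDomain U) :
    scal G z = -∑ i, ∑ j, (A (imPart z))⁻¹ i j *
      ∑ l, pderiv i (hessianConn A l l j) (imPart z) := by
  simp only [scal, Fintype.sum_sum_type, inv_tube hA hG hz, ricci_tube hA hG hz]
  simp
  ring

end Curvature

end TubeMetric

/-! ### Symmetries and Euler identities for the derivatives of `h`; nondegeneracy of its Hessian. -/

namespace IsRMapDatum

variable {m : ℕ} {D : ℝ} {U : Set (Fin m → ℝ)} {h : (Fin m → ℝ) → ℝ} (hU : IsRMapDatum D U h)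
  {x : Fin m → ℝ}

include hU

theorem contDiffOn_d1 (μ : Fin m) : ContDiffOn ℝ ∞ (d1 h μ) U :=
  contDiffOn_pderiv hU.isOpen hU.smooth μ

theorem contDiffOn_d2 (μ ν : Fin m) : ContDiffOn ℝ ∞ (d2 h μ ν) U :=
  contDiffOn_pderiv hU.isOpen (hU.contDiffOn_d1 ν) μ

theorem contDiffOn_d3 (μ ν κ : Fin m) : ContDiffOn ℝ ∞ (d3 h μ ν κ) U :=
  contDiffOn_pderiv hU.isOpen (hU.contDiffOn_d2 ν κ) μ

theorem differentiableAt (hx : x ∈ U) : DifferentiableAt ℝ h x :=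
  differentiableAt_of_contDiffOn hU.isOpen hU.smooth hx

theorem differentiableAt_d1 (hx : x ∈ U) (μ : Fin m) : DifferentiableAt ℝ (d1 h μ) x :=
  differentiableAt_of_contDiffOn hU.isOpen (hU.contDiffOn_d1 μ) hx

theorem differentiableAt_d2 (hx : x ∈ U) (μ ν : Fin m) : DifferentiableAt ℝ (d2 h μ ν) x :=
  differentiableAt_of_contDiffOn hU.isOpen (hU.contDiffOn_d2 μ ν) hx

theorem differentiableAt_d3 (hx : x ∈ U) (μ ν κ : Fin m) : DifferentiableAt ℝ (d3 h μ ν κ) x :=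
  differentiableAt_of_contDiffOn hU.isOpen (hU.contDiffOn_d3 μ ν κ) hx

theorem differentiableAt_inv (hx : x ∈ U) : DifferentiableAt ℝ (fun y => (h y)⁻¹) x :=
  (hU.differentiableAt hx).inv (hU.pos x hx).ne'

theorem d2_comm (hx : x ∈ U) (μ ν : Fin m) : d2 h μ ν x = d2 h ν μ x :=
  pderiv_comm hU.isOpen hU.smooth hx μ ν

theorem d3_comm₁₂ (hx : x ∈ U) (μ ν κ : Fin m) : d3 h μ ν κ x = d3 h ν μ κ x :=
  pderiv_comm hU.isOpen (hU.contDiffOn_d1 κ) hx μ ν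

theorem d3_comm₂₃ (hx : x ∈ U) (μ ν κ : Fin m) : d3 h μ ν κ x = d3 h μ κ ν x :=
  pderiv_congr hU.isOpen (fun _ hy => hU.d2_comm hy ν κ) hx μ

theorem d4_comm₁₂ (hx : x ∈ U) (μ ν κ τ : Fin m) : d4 h μ ν κ τ x = d4 h ν μ κ τ x :=
  pderiv_comm hU.isOpen (hU.contDiffOn_d2 κ τ) hx μ ν

theorem d4_comm₂₃ (hx : x ∈ U) (μ ν κ τ : Fin m) : d4 h μ ν κ τ x = d4 h μ κ ν τ x :=
  pderiv_congr hU.isOpen (fun _ hy => hU.d3_comm₁₂ hy ν κ τ) hx μ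

theorem d4_comm₃₄ (hx : x ∈ U) (μ ν κ τ : Fin m) : d4 h μ ν κ τ x = d4 h μ ν τ κ x :=
  pderiv_congr hU.isOpen (fun _ hy => hU.d3_comm₂₃ hy ν κ τ) hx μ

theorem d1_homogeneous (μ : Fin m) (r : ℝ) (hr : 0 < r) (x : Fin m → ℝ) (hx : x ∈ U) :
    d1 h μ (r • x) = r ^ (D - 1) * d1 h μ x :=
  pderiv_homogeneous hU.isOpen hU.smul_mem hU.smooth hU.homogeneous μ r hr x hx

theorem d2_homogeneous (μ ν : Fin m) (r : ℝ) (hr : 0 < r) (x : Fin m → ℝ) (hx : x ∈ U) :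
    d2 h μ ν (r • x) = r ^ (D - 1 - 1) * d2 h μ ν x :=
  pderiv_homogeneous hU.isOpen hU.smul_mem (hU.contDiffOn_d1 ν) (hU.d1_homogeneous ν) μ r hr x hx

theorem d3_homogeneous (μ ν κ : Fin m) (r : ℝ) (hr : 0 < r) (x : Fin m → ℝ) (hx : x ∈ U) :
    d3 h μ ν κ (r • x) = r ^ (D - 1 - 1 - 1) * d3 h μ ν κ x :=
  pderiv_homogeneous hU.isOpen hU.smul_mem (hU.contDiffOn_d2 ν κ) (hU.d2_homogeneous ν κ) μ r hr
    x hx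

theorem euler_d1 (hx : x ∈ U) : ∑ μ, x μ * d1 h μ x = D * h x :=
  euler_identity hU.isOpen hU.smooth hU.homogeneous hx

theorem euler_d2 (hx : x ∈ U) (ν : Fin m) : ∑ μ, x μ * d2 h μ ν x = (D - 1) * d1 h ν x :=
  euler_identity hU.isOpen (hU.contDiffOn_d1 ν) (hU.d1_homogeneous ν) hx

theorem euler_d3 (hx : x ∈ U) (ν κ : Fin m) :
    ∑ μ, x μ * d3 h μ ν κ x = (D - 2) * d2 h ν κ x := by
  have := euler_identity hU.isOpen (hU.contDiffOn_d2 ν κ) (hU.d2_homogeneous ν κ) hx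
  rw [show D - 1 - 1 = D - 2 by ring] at this
  exact this

theorem euler_d4 (hx : x ∈ U) (ν κ τ : Fin m) :
    ∑ μ, x μ * d4 h μ ν κ τ x = (D - 3) * d3 h ν κ τ x := by
  have := euler_identity hU.isOpen (hU.contDiffOn_d3 ν κ τ) (hU.d3_homogeneous ν κ τ) hx
  rw [show D - 1 - 1 - 1 = D - 3 by ring] at this
  exact this

theorem sub_one_ne_zero : D - 1 ≠ 0 := sub_ne_zero.2 hU.degree_ne_one

theorem negHess_comm (hx : x ∈ U) (μ ν : Fin m) : negHess h x μ ν = negHess h x ν μ := by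
  simp [negHess, hU.d2_comm hx μ ν]

theorem sum_negHess_mul (hx : x ∈ U) (μ : Fin m) :
    ∑ ν, negHess h x μ ν * x ν = -((D - 1) * d1 h μ x) := by
  rw [← hU.euler_d2 hx μ, ← Finset.sum_neg_distrib]
  refine Finset.sum_congr rfl fun ν _ => ?_
  simp [negHess, hU.d2_comm hx μ ν]
  ring

/-- The factor r = h(x)^(-1/D) moves `x` to the level set h = 1; dh and ∂²h only change by positive
powers of r, so tangency and sign are preserved. -/
theorem tangent_pos' (hx : x ∈ U) (v : Fin m → ℝ) (hv : v ≠ 0) (ht : ∑ μ, d1 h μ x * v μ = 0) :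
    0 < ∑ μ, ∑ ν, negHess h x μ ν * v μ * v ν := by
  have hp := hU.pos x hx
  have hr : 0 < (h x) ^ (-1 / D) := Real.rpow_pos_of_pos hp _
  set r := (h x) ^ (-1 / D) with hrdef
  have h1 : h (r • x) = 1 := by
    rw [hU.homogeneous r hr x hx, hrdef, ← Real.rpow_mul hp.le,
      div_mul_cancel₀ _ hU.degree_pos.ne', Real.rpow_neg_one, inv_mul_cancel₀ hp.ne']
  have h2 := hU.tangent_pos (r • x) (hU.smul_mem r hr x hx) h1 v hv (by
    simp only [hU.d1_homogeneous _ r hr x hx, mul_assoc, ← Finset.mul_sum, ht, mul_zero])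
  have h3 : ∑ μ, ∑ ν, negHess h (r • x) μ ν * v μ * v ν
      = r ^ (D - 1 - 1) * ∑ μ, ∑ ν, negHess h x μ ν * v μ * v ν := by
    simp only [Finset.mul_sum]
    refine Finset.sum_congr rfl fun μ _ => Finset.sum_congr rfl fun ν _ => ?_
    simp only [negHess, Matrix.of_apply, hU.d2_homogeneous _ _ r hr x hx]
    ring
  rw [h3] at h2
  exact pos_of_mul_pos_right h2 (Real.rpow_pos_of_pos hr _).le

/-- The decomposition of `-∂²h` with respect to the splitting of the tangent space into the
radial direction and the kernel of `dh`. -/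
theorem negHess_add_smul (hx : x ∈ U) (t : Fin m → ℝ) (ht : ∑ μ, d1 h μ x * t μ = 0) (a : ℝ) :
    ∑ μ, ∑ ν, negHess h x μ ν * (t μ + a * x μ) * (t ν + a * x ν) =
      (∑ μ, ∑ ν, negHess h x μ ν * t μ * t ν) - a ^ 2 * ((D - 1) * (D * h x)) := by
  have e1 : ∑ μ, ∑ ν, negHess h x μ ν * (t μ + a * x μ) * (t ν + a * x ν) =
      (∑ μ, ∑ ν, negHess h x μ ν * t μ * t ν) + a * (∑ μ, t μ * ∑ ν, negHess h x μ ν * x ν)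
      + a * (∑ μ, ∑ ν, negHess h x μ ν * x μ * t ν)
      + a ^ 2 * (∑ μ, x μ * ∑ ν, negHess h x μ ν * x ν) := by
    simp only [Finset.mul_sum, ← Finset.sum_add_distrib]
    refine Finset.sum_congr rfl fun μ _ => Finset.sum_congr rfl fun ν _ => ?_
    ring
  have e2 : ∑ ν, t ν * ∑ μ, negHess h x ν μ * x μ = ∑ μ, ∑ ν, negHess h x μ ν * x μ * t ν := by
    rw [Finset.sum_comm]
    simp only [Finset.mul_sum]
    refine Finset.sum_congr rfl fun μ _ => Finset.sum_congr rfl fun ν _ => ?_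
    rw [hU.negHess_comm hx]
    ring
  -- Since N x = -(D-1) dh, the radial direction is N-orthogonal to ker dh, and N(x, x) = -(D-1) D
  -- h.
  have e3 : ∑ μ, t μ * ∑ ν, negHess h x μ ν * x ν = 0 := by
    simp only [hU.sum_negHess_mul hx]
    rw [← mul_zero (-(D - 1)), ← ht, Finset.mul_sum]
    exact Finset.sum_congr rfl fun μ _ => by ring
  have e4 : ∑ μ, x μ * ∑ ν, negHess h x μ ν * x ν = -((D - 1) * (D * h x)) := by
    simp only [hU.sum_negHess_mul hx]
    rw [← hU.euler_d1 hx, Finset.mul_sum, ← Finset.sum_neg_distrib]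
    exact Finset.sum_congr rfl fun μ _ => by ring
  rw [e1, ← e2, e3, e4]
  ring

/-- By Euler dh(x) = D h ≠ 0, so `x` is transverse to ker dh and a = dh(v)/(D h). -/
theorem exists_radial_decomposition (hx : x ∈ U) (v : Fin m → ℝ) :
    ∃ (t : Fin m → ℝ) (a : ℝ), (∀ μ, v μ = t μ + a * x μ) ∧ ∑ μ, d1 h μ x * t μ = 0 ∧
      ∑ μ, d1 h μ x * v μ = a * (D * h x) := by
  have hne : D * h x ≠ 0 := (mul_pos hU.degree_pos (hU.pos x hx)).ne'
  have he : ∑ μ, d1 h μ x * x μ = D * h x := by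
    rw [← hU.euler_d1 hx]; exact Finset.sum_congr rfl fun μ _ => mul_comm _ _
  refine ⟨fun μ => v μ - (∑ μ, d1 h μ x * v μ) / (D * h x) * x μ,
    (∑ μ, d1 h μ x * v μ) / (D * h x), fun μ => by ring, ?_,
    (div_mul_cancel₀ _ hne).symm⟩
  have : ∀ μ, d1 h μ x * (v μ - (∑ μ, d1 h μ x * v μ) / (D * h x) * x μ)
      = d1 h μ x * v μ - (∑ μ, d1 h μ x * v μ) / (D * h x) * (d1 h μ x * x μ) := fun μ => by ring
  simp only [this, Finset.sum_sub_distrib, ← Finset.mul_sum, he]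
  rw [div_mul_cancel₀ _ hne, sub_self]

/-- For a null vector v, pairing with x gives (D-1) dh(v) = 0. As D ≠ 1, v lies in ker dh, where the
form is positive definite. -/
theorem negHess_det_ne_zero (hx : x ∈ U) : (negHess h x).det ≠ 0 := by
  intro h0
  obtain ⟨v, hv0, hv⟩ := Matrix.exists_mulVec_eq_zero_iff.2 h0
  have hv' : ∀ μ, ∑ ν, negHess h x μ ν * v ν = 0 := fun μ => congrFun hv μ
  -- pairing with `x` shows that `v` is tangent
  have h1 : ∑ μ, d1 h μ x * v μ = 0 := by
    have e : ∑ μ, x μ * ∑ ν, negHess h x μ ν * v ν = -(D - 1) * ∑ μ, d1 h μ x * v μ := by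
      simp only [Finset.mul_sum]
      rw [Finset.sum_comm]
      refine Finset.sum_congr rfl fun ν _ => ?_
      have := hU.sum_negHess_mul hx ν
      calc ∑ μ, x μ * (negHess h x μ ν * v ν) = (∑ μ, negHess h x ν μ * x μ) * v ν := by
            rw [Finset.sum_mul]
            refine Finset.sum_congr rfl fun μ _ => ?_
            rw [hU.negHess_comm hx]
            ring
        _ = _ := by rw [this]; ring
    simp only [hv', mul_zero, Finset.sum_const_zero] at e
    exact (mul_eq_zero.1 e.symm).resolve_left (neg_ne_zero.2 hU.sub_one_ne_zero)
  have h2 := hU.tangent_pos' hx v hv0 h1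
  have h3 : ∑ μ, ∑ ν, negHess h x μ ν * v μ * v ν = ∑ μ, v μ * ∑ ν, negHess h x μ ν * v ν := by
    simp only [Finset.mul_sum]
    exact Finset.sum_congr rfl fun μ _ => Finset.sum_congr rfl fun ν _ => by ring
  rw [h3] at h2
  simp [hv'] at h2

end IsRMapDatum

/-! ### The Hessian of -log h and the metric of the r-map. -/

/-- The Kähler potential as a function of `x = Im z`. -/
def realPotential {m : ℕ} (h : (Fin m → ℝ) → ℝ) (x : Fin m → ℝ) : ℝ := -Real.log (h x)

/-- The Hessian of `-log h`. -/
def potentialHess {m : ℕ} (h : (Fin m → ℝ) → ℝ) (x : Fin m → ℝ) : Matrix (Fin m) (Fin m) ℝ :=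
  Matrix.of fun μ ν => pderiv μ (pderiv ν (realPotential h)) x

/-- One half of the Hessian of `-log h`: the restriction of the metric of the r-map to the real and
to the imaginary directions. -/
def halfHess {m : ℕ} (h : (Fin m → ℝ) → ℝ) (x : Fin m → ℝ) : Matrix (Fin m) (Fin m) ℝ :=
  Matrix.of fun μ ν => (1 / 2) * potentialHess h x μ ν

/-- A block diagonal matrix with equal positive definite blocks is positive definite. -/
theorem posDef_fromBlocks_self {m : ℕ} {A : Matrix (Fin m) (Fin m) ℝ} (hA : A.PosDef) :
    (Matrix.fromBlocks A 0 0 A).PosDef := by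
  refine Matrix.PosDef.of_dotProduct_mulVec_pos ?_ fun v hv => ?_
  · rw [Matrix.IsHermitian, Matrix.fromBlocks_conjTranspose, hA.1]
    simp
  · have hsplit : ∀ w : Fin m ⊕ Fin m → ℝ, star w ⬝ᵥ (Matrix.fromBlocks A 0 0 A).mulVec w
        = star (w ∘ Sum.inl) ⬝ᵥ A.mulVec (w ∘ Sum.inl)
          + star (w ∘ Sum.inr) ⬝ᵥ A.mulVec (w ∘ Sum.inr) := by
      intro w
      rw [Matrix.fromBlocks_mulVec]
      simp [dotProduct, Fintype.sum_sum_type]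
    rw [hsplit]
    by_cases h1 : v ∘ Sum.inl = 0
    · have h2 : v ∘ Sum.inr ≠ 0 := by
        intro h2
        refine hv (funext fun i => ?_)
        rcases i with i | i
        · exact congrFun h1 i
        · exact congrFun h2 i
      exact add_pos_of_nonneg_of_pos (hA.posSemidef.dotProduct_mulVec_nonneg _)
        (hA.dotProduct_mulVec_pos h2)
    · exact add_pos_of_pos_of_nonneg (hA.dotProduct_mulVec_pos h1)
        (hA.posSemidef.dotProduct_mulVec_nonneg _)

/-- The constant `c` allows iteration: the first derivative of the potential is i/2 times a real
function of x. -/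
theorem complexDeriv_tube {m : ℕ} {U : Set (Fin m → ℝ)} (hU : IsOpen U) {F : (Fin m → ℂ) → ℂ}
    {g : (Fin m → ℝ) → ℝ} {c : ℂ} {z : Fin m → ℂ} (hz : z ∈ tubeDomain U)
    (hF : ∀ w ∈ tubeDomain U, F w = c * (g (imPart w) : ℂ))
    (hg : DifferentiableAt ℝ g (imPart z)) (a : Fin m ⊕ Fin m → ℂ) :
    complexDeriv a F z = c * ∑ μ, a (Sum.inr μ) * (pderiv μ g (imPart z) : ℂ) := by
  have h1 : HasFDerivAt (fun x => c * (g x : ℂ))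
      (c • (Complex.ofRealCLM.comp (fderiv ℝ g (imPart z)))) (imPart z) :=
    (Complex.ofRealCLM.hasFDerivAt.comp (imPart z) hg.hasFDerivAt).const_mul c
  have h2 : ∀ v, fderiv ℝ F z v = c * (fderiv ℝ g (imPart z) (imPart v) : ℂ) := fun v => by
    rw [fderiv_of_eqOn_tube (f := fun x => c * (g x : ℂ)) hU hF hz h1.differentiableAt, h1.fderiv]
    simp
  simp only [complexDeriv, Fintype.sum_sum_type, h2, imPart_coordVec_inl, imPart_coordVec_inr,
    map_zero, pderiv, Finset.mul_sum]
  simp only [Complex.ofReal_zero, mul_zero, Finset.sum_const_zero, zero_add]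
  exact Finset.sum_congr rfl fun μ _ => by ring

namespace IsRMapDatum

variable {m : ℕ} {D : ℝ} {U : Set (Fin m → ℝ)} {h : (Fin m → ℝ) → ℝ} (hU : IsRMapDatum D U h)
  {x : Fin m → ℝ}

include hU

theorem contDiffOn_realPotential : ContDiffOn ℝ ∞ (realPotential h) U :=
  (hU.smooth.log fun x hx => (hU.pos x hx).ne').neg

theorem pderiv_realPotential (hx : x ∈ U) (ν : Fin m) :
    pderiv ν (realPotential h) x = -(d1 h ν x * (h x)⁻¹) := by
  unfold realPotential
  rw [pderiv_neg, pderiv_log (hU.differentiableAt hx) (hU.pos x hx).ne', div_eq_mul_inv]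
  rfl

theorem potentialHess_apply (hx : x ∈ U) (μ ν : Fin m) : potentialHess h x μ ν =
    -(d2 h μ ν x * (h x)⁻¹) + d1 h μ x * d1 h ν x * ((h x)⁻¹ * (h x)⁻¹) := by
  rw [potentialHess, Matrix.of_apply, pderiv_congr hU.isOpen
    (fun _ hy => hU.pderiv_realPotential hy ν) hx, pderiv_neg,
    pderiv_mul (hU.differentiableAt_d1 hx ν) (hU.differentiableAt_inv hx),
    pderiv_inv (hU.differentiableAt hx) (hU.pos x hx).ne']
  change -(d2 h μ ν x * _ + _ * (-d1 h μ x / _)) = _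
  have := (hU.pos x hx).ne'
  field_simp
  ring

theorem potentialHess_comm (hx : x ∈ U) (μ ν : Fin m) :
    potentialHess h x μ ν = potentialHess h x ν μ := by
  rw [hU.potentialHess_apply hx, hU.potentialHess_apply hx, hU.d2_comm hx]
  ring

/-- On v = t + a x the radial part of N/h gives -a² D(D-1), and dh⊗dh/h² gives a² D². Their sum a² D
is positive whatever the sign of D-1. -/
theorem halfHess_posDef (hx : x ∈ U) : (halfHess h x).PosDef := by
  have hp := hU.pos x hx
  refine Matrix.PosDef.of_dotProduct_mulVec_pos ?_ fun v hv => ?_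
  · ext i j
    simp [halfHess, hU.potentialHess_comm hx i j]
  obtain ⟨t, a, hv', ht, hva⟩ := hU.exists_radial_decomposition hx v
  have h1 : star v ⬝ᵥ (halfHess h x).mulVec v
      = (1 / 2) * ((∑ μ, ∑ ν, negHess h x μ ν * v μ * v ν) * (h x)⁻¹
        + (∑ μ, d1 h μ x * v μ) * (∑ μ, d1 h μ x * v μ) * ((h x)⁻¹ * (h x)⁻¹)) := by
    simp only [dotProduct, Matrix.mulVec, Finset.sum_mul_sum]
    simp only [Finset.mul_sum, Finset.sum_mul, ← Finset.sum_add_distrib]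
    refine Finset.sum_congr rfl fun μ _ => Finset.sum_congr rfl fun ν _ => ?_
    simp [halfHess, hU.potentialHess_apply hx, negHess]
    ring
  have h2 : ∑ μ, ∑ ν, negHess h x μ ν * v μ * v ν
      = (∑ μ, ∑ ν, negHess h x μ ν * t μ * t ν) - a ^ 2 * ((D - 1) * (D * h x)) := by
    rw [← hU.negHess_add_smul hx t ht a]
    simp only [hv']
  have h3 : star v ⬝ᵥ (halfHess h x).mulVec v
      = (1 / 2) * ((∑ μ, ∑ ν, negHess h x μ ν * t μ * t ν) * (h x)⁻¹ + a ^ 2 * D) := by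
    rw [h1, h2, hva]
    field_simp
    ring
  rw [h3]
  by_cases h0 : t = 0
  · have ha : a ≠ 0 := by
      rintro rfl
      exact hv (funext fun μ => by simp [hv', h0])
    have := hU.degree_pos
    simp only [h0, Pi.zero_apply, mul_zero, Finset.sum_const_zero, zero_mul, zero_add]
    positivity
  · have := hU.tangent_pos' hx t h0 ht
    have := hU.degree_pos
    positivity

theorem halfHess_det_ne_zero (hx : x ∈ U) : (halfHess h x).det ≠ 0 :=
  (hU.halfHess_posDef hx).det_pos.ne'

theorem contDiffOn_pderiv_pderiv (μ ν : Fin m) :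
    ContDiffOn ℝ ∞ (pderiv μ (pderiv ν (realPotential h))) U :=
  contDiffOn_pderiv hU.isOpen (contDiffOn_pderiv hU.isOpen hU.contDiffOn_realPotential ν) μ

theorem isHessianMetric : IsHessianMetric U (halfHess h) where
  isOpen := hU.isOpen
  smooth k l := contDiffOn_const.mul (hU.contDiffOn_pderiv_pderiv k l)
  det_ne_zero _ hy := hU.halfHess_det_ne_zero hy
  symm y hy k l := by simp [halfHess, hU.potentialHess_comm hy k l]
  codazzi y hy i j k := by
    have hd : ∀ j, DifferentiableAt ℝ (pderiv j (pderiv k (realPotential h))) y := fun j =>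
      differentiableAt_of_contDiffOn hU.isOpen (hU.contDiffOn_pderiv_pderiv j k) hy
    have e : ∀ i j, pderiv i (fun w => halfHess h w j k) y
        = (1 / 2) * pderiv i (pderiv j (pderiv k (realPotential h))) y :=
      fun i j => pderiv_const_mul (hd j) _ _
    rw [e, e, pderiv_comm hU.isOpen
      (contDiffOn_pderiv hU.isOpen hU.contDiffOn_realPotential k) hy]

variable {z : Fin m → ℂ}

/-- On functions of x, ∂/∂z and ∂/∂z̄ are -i/2 and i/2 times ∂/∂x, and the product of these factors
is 1/4. -/
theorem kahlerCoeff_potential (hz : z ∈ tubeDomain U) (μ ν : Fin m) :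
    kahlerCoeff (potential h) z μ ν = ((1 / 4 * potentialHess h (imPart z) μ ν : ℝ) : ℂ) := by
  have h1 : ∀ w ∈ tubeDomain U, complexDeriv (delZbar ν) (fun w => (potential h w : ℂ)) w
      = Complex.I / 2 * (pderiv ν (realPotential h) (imPart w) : ℂ) := by
    intro w hw
    rw [complexDeriv_tube (g := realPotential h) (c := 1) hU.isOpen hw
      (fun w _ => by rw [one_mul]; rfl)
      (differentiableAt_of_contDiffOn hU.isOpen hU.contDiffOn_realPotential hw)]
    simp [delZbar]
  rw [kahlerCoeff, Matrix.of_apply, complexDeriv_tube hU.isOpen hz h1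
    (differentiableAt_of_contDiffOn hU.isOpen
      (contDiffOn_pderiv hU.isOpen hU.contDiffOn_realPotential ν) hz)]
  simp [delZ, potentialHess]
  ring_nf
  simp only [Complex.I_sq]
  ring

/-- On the diagonal blocks each of the two terms of the symmetric product contributes a quarter of
the Hessian; on the mixed blocks the products are purely imaginary. -/
theorem rMapMetric_eq_fromBlocks (hz : z ∈ tubeDomain U) : rMapMetric h z =
    Matrix.fromBlocks (halfHess h (imPart z)) 0 0 (halfHess h (imPart z)) := by
  have hx : imPart z ∈ U := hz
  ext i j
  rcases i with i | i <;> rcases j with j | j <;>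
    simp only [rMapMetric, kahlerMetric, Matrix.of_apply, hU.kahlerCoeff_potential hz, dz,
      Matrix.fromBlocks_apply₁₁, Matrix.fromBlocks_apply₁₂, Matrix.fromBlocks_apply₂₁,
      Matrix.fromBlocks_apply₂₂, Matrix.zero_apply, halfHess, mul_add, Finset.sum_add_distrib] <;>
    simp [apply_ite (starRingEnd ℂ)] <;>
    rw [hU.potentialHess_comm hx j i] <;> ring

end IsRMapDatum

/-! ### The inverse metric, the connection of the r-map and its derivative. -/

theorem sum_kdelta_mul {m : ℕ} (ρ : Fin m) (F : Fin m → ℝ) : ∑ κ, kdelta ρ κ * F κ = F ρ := by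
  simp [kdelta]

theorem kdelta_comm {m : ℕ} (ρ σ : Fin m) : kdelta ρ σ = kdelta σ ρ := by
  simp [kdelta, eq_comm]

theorem kdelta_self {m : ℕ} (ρ : Fin m) : kdelta ρ ρ = 1 := by simp [kdelta]

namespace IsRMapDatum

variable {m : ℕ} {D : ℝ} {U : Set (Fin m → ℝ)} {h : (Fin m → ℝ) → ℝ} (hU : IsRMapDatum D U h)
  {x : Fin m → ℝ}

include hU

theorem negHess_inv_comm (hx : x ∈ U) (μ ν : Fin m) :
    (negHess h x)⁻¹ μ ν = (negHess h x)⁻¹ ν μ := by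
  have h1 : (negHess h x).transpose = negHess h x := by
    ext i j; exact hU.negHess_comm hx j i
  have h2 : ((negHess h x)⁻¹).transpose = (negHess h x)⁻¹ := by
    rw [Matrix.transpose_nonsing_inv, h1]
  exact (congrFun (congrFun h2 μ) ν).symm

theorem sum_inv_mul_d2 (hx : x ∈ U) (ρ ν : Fin m) :
    ∑ κ, (negHess h x)⁻¹ ρ κ * d2 h κ ν x = -kdelta ρ ν := by
  have h1 := congrFun (congrFun
    (Matrix.nonsing_inv_mul _ (hU.negHess_det_ne_zero hx).isUnit) ρ) ν
  rw [Matrix.mul_apply, Matrix.one_apply] at h1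
  simp only [negHess, Matrix.of_apply, mul_neg, Finset.sum_neg_distrib] at h1
  rw [kdelta, ← h1, neg_neg]
  rfl

/-- Euler's identity for the first derivatives, solved for dh, reads dh = -N x/(D-1); applying N⁻¹
gives the claim. -/
theorem sum_inv_mul_d1 (hx : x ∈ U) (ρ : Fin m) :
    ∑ κ, (negHess h x)⁻¹ ρ κ * d1 h κ x = -(1 / (D - 1) * x ρ) := by
  have h0 := hU.sub_one_ne_zero
  have h1 : ∀ κ, d1 h κ x = 1 / (D - 1) * ∑ μ, x μ * d2 h κ μ x := fun κ => by
    have := hU.euler_d2 hx κ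
    simp only [fun μ => hU.d2_comm hx κ μ, this]
    field_simp
  have h2 : ∑ κ, (negHess h x)⁻¹ ρ κ * d1 h κ x
      = 1 / (D - 1) * ∑ μ, (∑ κ, (negHess h x)⁻¹ ρ κ * d2 h κ μ x) * x μ := by
    simp only [h1, Finset.mul_sum, Finset.sum_mul]
    rw [Finset.sum_comm]
    exact Finset.sum_congr rfl fun μ _ => Finset.sum_congr rfl fun κ _ => by ring
  rw [h2]
  simp only [hU.sum_inv_mul_d2 hx, neg_mul, Finset.sum_neg_distrib, sum_kdelta_mul]
  ring

/-- The inverse of the Hessian of `-log h`. -/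
theorem halfHess_inv_apply (hx : x ∈ U) (ρ κ : Fin m) : (halfHess h x)⁻¹ ρ κ =
    2 * (h x * (negHess h x)⁻¹ ρ κ + 1 / (D - 1) * (x ρ * x κ)) := by
  have h0 := hU.sub_one_ne_zero
  have hp := (hU.pos x hx).ne'
  -- The candidate is the Sherman–Morrison inverse of ½ (N/h + dh⊗dh/h²), with N⁻¹ dh = -x/(D-1) and
  -- denominator 1 - D/(D-1) = -1/(D-1).
  have h1 : Matrix.of (fun ρ κ =>
      2 * (h x * (negHess h x)⁻¹ ρ κ + 1 / (D - 1) * (x ρ * x κ))) * halfHess h x = 1 := by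
    ext i j
    rw [Matrix.mul_apply]
    have e : ∀ k, (Matrix.of (fun ρ κ =>
        2 * (h x * (negHess h x)⁻¹ ρ κ + 1 / (D - 1) * (x ρ * x κ)))) i k * halfHess h x k j
        = -((negHess h x)⁻¹ i k * d2 h k j x)
          + d1 h j x * (h x)⁻¹ * ((negHess h x)⁻¹ i k * d1 h k x)
          - 1 / (D - 1) * x i * (h x)⁻¹ * (x k * d2 h k j x)
          + 1 / (D - 1) * x i * d1 h j x * ((h x)⁻¹ * (h x)⁻¹) * (x k * d1 h k x) := by
      intro k
      simp only [Matrix.of_apply, halfHess, hU.potentialHess_apply hx]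
      field_simp
      ring
    simp only [e, Finset.sum_add_distrib, Finset.sum_sub_distrib, ← Finset.mul_sum,
      Finset.sum_neg_distrib, hU.sum_inv_mul_d2 hx, hU.sum_inv_mul_d1 hx, hU.euler_d2 hx,
      hU.euler_d1 hx, Matrix.one_apply, kdelta]
    field_simp
    ring
  rw [Matrix.inv_eq_left_inv h1, Matrix.of_apply]

theorem pderiv_halfHess (hx : x ∈ U) (i j l : Fin m) :
    pderiv i (fun y => halfHess h y j l) x = (1 / 2) * (-(d3 h i j l x * (h x)⁻¹)
      + (d2 h j l x * d1 h i x + d2 h i j x * d1 h l x + d1 h j x * d2 h i l x)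
        * ((h x)⁻¹ * (h x)⁻¹)
      - 2 * d1 h i x * d1 h j x * d1 h l x * ((h x)⁻¹ * (h x)⁻¹ * (h x)⁻¹)) := by
  have hp := (hU.pos x hx).ne'
  have hinv := hU.differentiableAt_inv hx
  have e : Set.EqOn (fun y => halfHess h y j l) (fun y => (1 / 2) * (-(d2 h j l y * (h y)⁻¹) +
      d1 h j y * d1 h l y * ((h y)⁻¹ * (h y)⁻¹))) U := fun y hy => by
    simp only [halfHess, Matrix.of_apply, hU.potentialHess_apply hy]
  have d2' := (hU.differentiableAt_d2 hx j l).fun_mul hinv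
  have d1' := (hU.differentiableAt_d1 hx j).fun_mul (hU.differentiableAt_d1 hx l)
  have dii := hinv.fun_mul hinv
  rw [pderiv_congr hU.isOpen e hx, pderiv_const_mul (d2'.fun_neg.fun_add (d1'.fun_mul dii)),
    pderiv_add d2'.fun_neg (d1'.fun_mul dii), pderiv_neg,
    pderiv_mul (hU.differentiableAt_d2 hx j l) hinv, pderiv_mul d1' dii, pderiv_mul hinv hinv,
    pderiv_mul (hU.differentiableAt_d1 hx j) (hU.differentiableAt_d1 hx l),
    pderiv_inv (hU.differentiableAt hx) hp]
  change (1 / 2) * (-(d3 h i j l x * _ + _ * (-d1 h i x / _)) +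
    ((d2 h i j x * _ + _ * d2 h i l x) * _ + _ * (-d1 h i x / _ * _ + _ * (-d1 h i x / _)))) = _
  field_simp
  ring

/-- The connection of the r-map in terms of the derivatives of `h`. -/
theorem hessianConn_halfHess (hx : x ∈ U) (k i j : Fin m) :
    hessianConn (halfHess h) k i j x = (1 / 2) * (-d3Up1 h k i j x
      - (kdelta k i * d1 h j x + kdelta k j * d1 h i x) * (h x)⁻¹
      + 1 / (D - 1) * (x k * (d2 h i j x * (h x)⁻¹))) := by
  have h0 := hU.sub_one_ne_zero
  have hp := (hU.pos x hx).ne'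
  -- The product is grouped so that each sum over `l` is `d3Up1`, a contraction of N⁻¹ with dh or
  -- ∂²h, or an Euler identity.
  have e : ∀ l, (halfHess h x)⁻¹ k l * pderiv i (fun y => halfHess h y j l) x =
      -((negHess h x)⁻¹ k l * d3 h l i j x)
      + (d2 h i j x * (h x)⁻¹ - 2 * d1 h i x * d1 h j x * ((h x)⁻¹ * (h x)⁻¹))
        * ((negHess h x)⁻¹ k l * d1 h l x)
      + d1 h i x * (h x)⁻¹ * ((negHess h x)⁻¹ k l * d2 h l j x)
      + d1 h j x * (h x)⁻¹ * ((negHess h x)⁻¹ k l * d2 h l i x)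
      - 1 / (D - 1) * x k * (h x)⁻¹ * (x l * d3 h l i j x)
      + 1 / (D - 1) * x k * ((h x)⁻¹ * (h x)⁻¹) * d1 h i x * (x l * d2 h l j x)
      + 1 / (D - 1) * x k * ((h x)⁻¹ * (h x)⁻¹) * d1 h j x * (x l * d2 h l i x)
      + 1 / (D - 1) * x k * (d2 h i j x * ((h x)⁻¹ * (h x)⁻¹)
        - 2 * d1 h i x * d1 h j x * ((h x)⁻¹ * (h x)⁻¹ * (h x)⁻¹)) * (x l * d1 h l x) := by
    intro l
    rw [hU.halfHess_inv_apply hx, hU.pderiv_halfHess hx, hU.d3_comm₂₃ hx i j l,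
      hU.d3_comm₁₂ hx i l j, hU.d2_comm hx j l, hU.d2_comm hx i l]
    field_simp
    ring
  simp only [hessianConn, e, Finset.sum_add_distrib, Finset.sum_sub_distrib, ← Finset.mul_sum,
    Finset.sum_neg_distrib, hU.sum_inv_mul_d2 hx, hU.sum_inv_mul_d1 hx, hU.euler_d2 hx,
    hU.euler_d1 hx, hU.euler_d3 hx, d3Up1]
  field_simp
  ring

theorem differentiableAt_negHess (hx : x ∈ U) (μ ν : Fin m) :
    DifferentiableAt ℝ (fun y => negHess h y μ ν) x :=
  (hU.differentiableAt_d2 hx μ ν).fun_neg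

theorem differentiableAt_d3Up1 (hx : x ∈ U) (ρ μ σ : Fin m) :
    DifferentiableAt ℝ (d3Up1 h ρ μ σ) x :=
  DifferentiableAt.fun_sum fun κ _ => (differentiableAt_matrix_inv (hU.differentiableAt_negHess hx)
    (hU.negHess_det_ne_zero hx) ρ κ).fun_mul (hU.differentiableAt_d3 hx κ μ σ)

/-- The derivative of N⁻¹ is -N⁻¹ (∂N) N⁻¹ and ∂N = -∂³h, so the quadratic term has a plus sign. -/
theorem pderiv_d3Up1 (hx : x ∈ U) (ν ρ μ σ : Fin m) : pderiv ν (d3Up1 h ρ μ σ) x =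
    d4Up1 h ρ σ μ ν x + ∑ β, d3Up1 h ρ ν β x * d3Up1 h β σ μ x := by
  have h1 := pderiv_inv_mulVec (b := fun κ => d3 h κ μ σ) hU.isOpen hx
    (hU.differentiableAt_negHess hx) (fun κ => hU.differentiableAt_d3 hx κ μ σ)
    (fun y hy => hU.negHess_det_ne_zero hy) ρ ν
  have h2 : ∀ α κ, pderiv ν (fun y => negHess h y α κ) x = -d3 h α ν κ x := fun α κ => by
    rw [hU.d3_comm₁₂ hx]
    exact pderiv_neg ν
  have h3 : ∀ α, pderiv ν (d3 h α μ σ) x = d4 h α σ μ ν x := fun α => by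
    change d4 h ν α μ σ x = _
    rw [hU.d4_comm₁₂ hx, hU.d4_comm₂₃ hx, hU.d4_comm₃₄ hx, hU.d4_comm₂₃ hx]
  have h4 : ∀ β, ∑ τ, (negHess h x)⁻¹ β τ * d3 h τ μ σ x = d3Up1 h β σ μ x := fun β =>
    Finset.sum_congr rfl fun τ _ => by rw [hU.d3_comm₂₃ hx]
  refine Eq.trans h1 ?_
  simp only [h2, h3, h4, d4Up1, neg_mul, Finset.sum_neg_distrib, sub_neg_eq_add,
    mul_add, Finset.sum_add_distrib]
  congr 1
  simp only [Finset.mul_sum]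
  rw [Finset.sum_comm]
  refine Finset.sum_congr rfl fun β _ => ?_
  rw [show d3Up1 h ρ ν β x = ∑ κ, (negHess h x)⁻¹ ρ κ * d3 h κ ν β x from rfl, Finset.sum_mul]
  exact Finset.sum_congr rfl fun κ _ => by ring

/-- The derivative of the connection of the r-map. -/
theorem pderiv_hessianConn (hx : x ∈ U) (ν ρ μ σ : Fin m) :
    pderiv ν (hessianConn (halfHess h) ρ μ σ) x = (1 / (2 * h x ^ 2)) *
      (-(h x ^ 2) * d4Up1 h ρ σ μ ν x
        + 1 / (D - 1) * x ρ * (h x * d3 h σ μ ν x - d2 h μ σ x * d1 h ν x)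
        + d1 h μ x * d1 h ν x * kdelta ρ σ + d1 h σ x * d1 h ν x * kdelta ρ μ
        - h x * (d2 h σ ν x * kdelta ρ μ + d2 h μ ν x * kdelta ρ σ
            - 1 / (D - 1) * d2 h μ σ x * kdelta ρ ν)
        - h x ^ 2 * ∑ β, d3Up1 h ρ ν β x * d3Up1 h β σ μ x) := by
  have h0 := hU.sub_one_ne_zero
  have hp := (hU.pos x hx).ne'
  have hinv := hU.differentiableAt_inv hx
  have a1 := hU.differentiableAt_d3Up1 hx ρ μ σ
  have a2 := (hU.differentiableAt_d1 hx σ).const_mul (kdelta ρ μ)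
  have a3 := (hU.differentiableAt_d1 hx μ).const_mul (kdelta ρ σ)
  have a4 := (a2.fun_add a3).fun_mul hinv
  have a5 := (hU.differentiableAt_d2 hx μ σ).fun_mul hinv
  have a6 : DifferentiableAt ℝ (fun y : Fin m → ℝ => y ρ) x := differentiableAt_apply ρ x
  have a7 := a6.fun_mul a5
  have a8 := a7.const_mul (1 / (D - 1))
  have e3 : pderiv ν (d2 h μ σ) x = d3 h σ μ ν x := by
    change d3 h ν μ σ x = _
    rw [hU.d3_comm₂₃ hx, hU.d3_comm₁₂ hx, hU.d3_comm₂₃ hx]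
  have e2 : ∀ α, pderiv ν (d1 h α) x = d2 h α ν x := fun α => hU.d2_comm hx ν α
  have e1 : pderiv ν h x = d1 h ν x := rfl
  have e0 : pderiv ν (fun y : Fin m → ℝ => y ρ) x = kdelta ρ ν := pderiv_apply ν ρ
  rw [pderiv_congr hU.isOpen (fun y hy => hU.hessianConn_halfHess hy ρ μ σ) hx,
    pderiv_const_mul ((a1.fun_neg.fun_sub a4).fun_add a8), pderiv_add (a1.fun_neg.fun_sub a4) a8,
    pderiv_sub a1.fun_neg a4, pderiv_neg, pderiv_const_mul a7, pderiv_mul a6 a5,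
    pderiv_mul (hU.differentiableAt_d2 hx μ σ) hinv, pderiv_mul (a2.fun_add a3) hinv,
    pderiv_add a2 a3, pderiv_const_mul (hU.differentiableAt_d1 hx σ),
    pderiv_const_mul (hU.differentiableAt_d1 hx μ), pderiv_inv (hU.differentiableAt hx) hp]
  have ed := hU.pderiv_d3Up1 hx ν ρ μ σ
  rw [ed, e0, e1, e2, e2, e3]
  field_simp
  ring

/-- The Kronecker terms contribute m + 1 copies of dh/h and the radial term, by Euler, cancels one
of them. So D drops out of the Ricci tensor, and as ∂(dh/h) = -∂²(-log h) the remaining m copies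
become its -m g term. -/
theorem sum_hessianConn (hx : x ∈ U) (ν : Fin m) :
    ∑ l, hessianConn (halfHess h) l l ν x =
      (1 / 2) * (-∑ l, d3Up1 h l l ν x - m * (d1 h ν x * (h x)⁻¹)) := by
  have h0 := hU.sub_one_ne_zero
  have e : ∀ l, hessianConn (halfHess h) l l ν x = (1 / 2) * (-d3Up1 h l l ν x)
      + (-(1 / 2) * (d1 h ν x * (h x)⁻¹)) - (1 / 2) * (h x)⁻¹ * (kdelta ν l * d1 h l x)
      + (1 / 2) * (1 / (D - 1)) * (h x)⁻¹ * (x l * d2 h l ν x) := fun l => by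
    rw [hU.hessianConn_halfHess hx, kdelta_self, kdelta_comm l ν]
    ring
  simp only [e, Finset.sum_add_distrib, Finset.sum_sub_distrib, ← Finset.mul_sum,
    sum_kdelta_mul, hU.euler_d2 hx, Finset.sum_neg_distrib, Finset.sum_const, Finset.card_univ,
    Fintype.card_fin, nsmul_eq_mul]
  field_simp
  ring

/-- The trace of the derivative of the connection of the r-map. -/
theorem sum_pderiv_hessianConn (hx : x ∈ U) (μ ν : Fin m) :
    ∑ l, pderiv μ (hessianConn (halfHess h) l l ν) x =
      (1 / 2) * (m * potentialHess h x μ ν - ∑ ρ, d4Up1 h ρ ρ μ ν x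
        - ∑ α, ∑ β, d3Up1 h α μ β x * d3Up1 h β ν α x) := by
  have hp := (hU.pos x hx).ne'
  have hinv := hU.differentiableAt_inv hx
  have a1 : ∀ l ∈ (Finset.univ : Finset (Fin m)), DifferentiableAt ℝ (d3Up1 h l l ν) x :=
    fun l _ => hU.differentiableAt_d3Up1 hx l l ν
  have a2 : DifferentiableAt ℝ (fun y => ∑ l, d3Up1 h l l ν y) x := DifferentiableAt.fun_sum a1
  have a3 := (hU.differentiableAt_d1 hx ν).fun_mul hinv
  have a4 := a3.const_mul (m : ℝ)
  have e4 : ∀ l, d4Up1 h l ν l μ x = d4Up1 h l l μ ν x := fun l =>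
    Finset.sum_congr rfl fun κ _ => by
      rw [hU.d4_comm₂₃ hx, hU.d4_comm₃₄ hx]
  have e2 : pderiv μ (d1 h ν) x = d2 h μ ν x := rfl
  have e1 : pderiv μ h x = d1 h μ x := rfl
  rw [← pderiv_sum (F := fun l => hessianConn (halfHess h) l l ν) _
    (fun l _ => hU.isHessianMetric.differentiableAt_conn hx l l ν),
    pderiv_congr hU.isOpen (fun y hy => hU.sum_hessianConn hy ν) hx,
    pderiv_const_mul (a2.fun_neg.fun_sub a4), pderiv_sub a2.fun_neg a4, pderiv_neg,
    pderiv_sum _ a1, pderiv_const_mul a3, pderiv_mul (hU.differentiableAt_d1 hx ν) hinv,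
    pderiv_inv (hU.differentiableAt hx) hp, hU.potentialHess_apply hx, e1, e2]
  simp only [hU.pderiv_d3Up1 hx, e4, Finset.sum_add_distrib]
  field_simp
  ring

end IsRMapDatum

/-! ### Contractions of the third and fourth derivatives; the scalar curvature. -/

namespace IsRMapDatum

variable {m : ℕ} {D : ℝ} {U : Set (Fin m → ℝ)} {h : (Fin m → ℝ) → ℝ} (hU : IsRMapDatum D U h)
  {x : Fin m → ℝ}

include hU

/-- Moving one factor N⁻¹ across turns h_μ^{αβ} h_{αβν} into the trace of a product of
endomorphisms, the form produced by differentiating the connection. -/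
theorem sum_d3Up2_mul_d3 (hx : x ∈ U) (μ ν : Fin m) :
    ∑ α, ∑ β, d3Up2 h μ α β x * d3 h α β ν x
      = ∑ α, ∑ β, d3Up1 h α μ β x * d3Up1 h β ν α x := by
  refine Finset.sum_congr rfl fun α _ => ?_
  have e1 : ∀ β, d3Up2 h μ α β x * d3 h α β ν x
      = ∑ τ, (negHess h x)⁻¹ τ β * d3Up1 h α μ τ x * d3 h β ν α x := fun β => by
    simp only [d3Up2, d3Up1, Finset.mul_sum, Finset.sum_mul]
    rw [Finset.sum_comm]
    refine Finset.sum_congr rfl fun τ _ => Finset.sum_congr rfl fun κ _ => ?_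
    rw [hU.negHess_inv_comm hx β τ, hU.d3_comm₁₂ hx μ κ τ, hU.d3_comm₁₂ hx α β ν,
      hU.d3_comm₂₃ hx β α ν]
    ring
  simp only [e1]
  rw [Finset.sum_comm]
  refine Finset.sum_congr rfl fun τ _ => ?_
  rw [show d3Up1 h τ ν α x = ∑ β, (negHess h x)⁻¹ τ β * d3 h β ν α x from rfl, Finset.mul_sum]
  exact Finset.sum_congr rfl fun β _ => by ring

theorem sum_mul_d3Up1 (hx : x ∈ U) (α β : Fin m) :
    ∑ i, x i * d3Up1 h α i β x = -((D - 2) * kdelta α β) := by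
  have e : ∑ i, x i * d3Up1 h α i β x
      = ∑ κ, (negHess h x)⁻¹ α κ * ∑ i, x i * d3 h i κ β x := by
    simp only [d3Up1, Finset.mul_sum]
    rw [Finset.sum_comm]
    refine Finset.sum_congr rfl fun κ _ => Finset.sum_congr rfl fun i _ => ?_
    rw [hU.d3_comm₁₂ hx]
    ring
  have e2 : ∑ κ, (negHess h x)⁻¹ α κ * ((D - 2) * d2 h κ β x)
      = (D - 2) * ∑ κ, (negHess h x)⁻¹ α κ * d2 h κ β x := by
    rw [Finset.mul_sum]
    exact Finset.sum_congr rfl fun κ _ => by ring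
  rw [e]
  simp only [hU.euler_d3 hx, e2, hU.sum_inv_mul_d2 hx, mul_neg]

/-- Contracted with x, each factor becomes -(D-2) times the identity, and the identity has trace m.
This and `sum_mul_mul_quartic` evaluate the x⊗x part of the inverse metric on the Ricci tensor. -/
theorem sum_mul_mul_quadratic (hx : x ∈ U) :
    ∑ i, ∑ j, x i * x j * ∑ α, ∑ β, d3Up1 h α i β x * d3Up1 h β j α x = (D - 2) ^ 2 * m := by
  have e : ∑ i, ∑ j, x i * x j * ∑ α, ∑ β, d3Up1 h α i β x * d3Up1 h β j α x
      = ∑ α, ∑ β, (∑ i, x i * d3Up1 h α i β x) * ∑ j, x j * d3Up1 h β j α x := by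
    simp only [Finset.sum_mul_sum]
    simp only [Finset.mul_sum]
    rw [Finset.sum_congr rfl fun i _ => Finset.sum_comm, Finset.sum_comm]
    refine Finset.sum_congr rfl fun α _ => ?_
    rw [Finset.sum_congr rfl fun i _ => Finset.sum_comm, Finset.sum_comm]
    refine Finset.sum_congr rfl fun β _ => ?_
    exact Finset.sum_congr rfl fun i _ => Finset.sum_congr rfl fun j _ => by ring
  have e2 : ∀ α β : Fin m, -((D - 2) * kdelta α β) * -((D - 2) * kdelta β α)
      = (D - 2) ^ 2 * (kdelta α β * kdelta β α) := fun α β => by ring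
  simp only [e, hU.sum_mul_d3Up1 hx, e2, ← Finset.mul_sum, sum_kdelta_mul, kdelta_self]
  simp

/-- Two Euler identities lower the fourth derivatives to (D-3)(D-2) ∂²h, and the trace of N⁻¹ ∂²h is
-m. -/
theorem sum_mul_mul_quartic (hx : x ∈ U) :
    ∑ i, ∑ j, x i * x j * ∑ ρ, d4Up1 h ρ ρ i j x = -((D - 2) * (D - 3) * m) := by
  have e : ∑ i, ∑ j, x i * x j * ∑ ρ, d4Up1 h ρ ρ i j x
      = ∑ ρ, ∑ κ, (negHess h x)⁻¹ ρ κ * ∑ j, x j * ∑ i, x i * d4 h i j κ ρ x := by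
    simp only [d4Up1, Finset.mul_sum]
    rw [Finset.sum_congr rfl fun i _ => Finset.sum_comm, Finset.sum_comm]
    refine Finset.sum_congr rfl fun ρ _ => ?_
    rw [Finset.sum_congr rfl fun i _ => Finset.sum_comm, Finset.sum_comm]
    refine Finset.sum_congr rfl fun κ _ => ?_
    rw [Finset.sum_comm]
    refine Finset.sum_congr rfl fun j _ => Finset.sum_congr rfl fun i _ => ?_
    rw [hU.d4_comm₂₃ hx κ ρ i j, hU.d4_comm₃₄ hx κ i ρ j, hU.d4_comm₁₂ hx κ i j ρ,
      hU.d4_comm₂₃ hx i κ j ρ]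
    ring
  have e1 : ∀ κ ρ, ∑ j, x j * ((D - 3) * d3 h j κ ρ x) = (D - 3) * ((D - 2) * d2 h κ ρ x) :=
    fun κ ρ => by
      rw [← hU.euler_d3 hx, Finset.mul_sum]
      exact Finset.sum_congr rfl fun j _ => by ring
  have e2 : ∀ ρ, ∑ κ, (negHess h x)⁻¹ ρ κ * ((D - 3) * ((D - 2) * d2 h κ ρ x))
      = -((D - 2) * (D - 3)) := fun ρ => by
    have := hU.sum_inv_mul_d2 hx ρ ρ
    rw [kdelta_self] at this
    rw [← mul_one ((D - 2) * (D - 3)), ← mul_neg, ← this, Finset.mul_sum]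
    exact Finset.sum_congr rfl fun κ _ => by ring
  rw [e]
  simp only [hU.euler_d4 hx, e1, e2]
  simp
  ring

theorem sum_inv_mul_quadratic (hx : x ∈ U) :
    ∑ i, ∑ j, (negHess h x)⁻¹ i j * ∑ α, ∑ β, d3Up1 h α i β x * d3Up1 h β j α x
      = ∑ α, ∑ β, ∑ γ, d3 h α β γ x * d3Up3 h α β γ x := by
  have e : ∀ α β γ, d3 h α β γ x * d3Up3 h α β γ x
      = ∑ i, (negHess h x)⁻¹ i γ * (d3Up2 h i α β x * d3 h α β γ x) := fun α β γ => by
    simp only [d3Up3, d3Up2, Finset.mul_sum, Finset.sum_mul]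
    rw [Finset.sum_congr rfl fun κ _ => Finset.sum_comm, Finset.sum_comm]
    refine Finset.sum_congr rfl fun i _ => Finset.sum_congr rfl fun κ _ =>
      Finset.sum_congr rfl fun τ _ => ?_
    rw [hU.negHess_inv_comm hx γ i, hU.d3_comm₂₃ hx κ τ i, hU.d3_comm₁₂ hx κ i τ]
    ring
  simp only [← hU.sum_d3Up2_mul_d3 hx, e]
  simp only [Finset.mul_sum]
  refine Finset.sum_comm.trans ((Finset.sum_congr rfl fun j _ => Finset.sum_comm.trans
    (Finset.sum_congr rfl fun α _ => Finset.sum_comm)).trans ?_)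
  exact Finset.sum_comm.trans (Finset.sum_congr rfl fun α _ => Finset.sum_comm)

theorem sum_inv_mul_quartic (hx : x ∈ U) :
    ∑ i, ∑ j, (negHess h x)⁻¹ i j * ∑ ρ, d4Up1 h ρ ρ i j x
      = ∑ μ, ∑ ν, d4Up2 h μ ν μ ν x := by
  have e : ∀ μ ν, d4Up2 h μ ν μ ν x
      = ∑ i, (negHess h x)⁻¹ i ν * ∑ κ, (negHess h x)⁻¹ μ κ * d4 h κ μ i ν x := fun μ ν => by
    simp only [d4Up2, Finset.mul_sum]
    rw [Finset.sum_comm]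
    refine Finset.sum_congr rfl fun i _ => Finset.sum_congr rfl fun κ _ => ?_
    rw [hU.negHess_inv_comm hx ν i, hU.d4_comm₂₃ hx κ i μ ν]
    ring
  simp only [e, d4Up1]
  simp only [Finset.mul_sum]
  exact Finset.sum_comm.trans
    ((Finset.sum_congr rfl fun j _ => Finset.sum_comm).trans Finset.sum_comm)

theorem sum_inv_mul_potentialHess (hx : x ∈ U) :
    ∑ i, ∑ j, (halfHess h x)⁻¹ i j * potentialHess h x i j = 2 * m := by
  have h1 := Matrix.nonsing_inv_mul _ (hU.halfHess_det_ne_zero hx).isUnit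
  have h2 : ∀ i, ∑ j, (halfHess h x)⁻¹ i j * potentialHess h x i j = 2 := fun i => by
    have h3 := congrFun (congrFun h1 i) i
    rw [Matrix.mul_apply, Matrix.one_apply_eq] at h3
    rw [← mul_one (2 : ℝ), ← h3, Finset.mul_sum]
    refine Finset.sum_congr rfl fun j _ => ?_
    rw [hU.potentialHess_comm hx, halfHess, Matrix.of_apply]
    ring
  simp [h2]
  ring

variable {z : Fin m → ℂ}

theorem scal_rMapMetric (hz : z ∈ tubeDomain U) : scal (rMapMetric h) z =
    -(m : ℝ) ^ 2 + (D - 2) / (D - 1) * m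
      + h (imPart z) * ∑ α, ∑ β, ∑ γ, d3 h α β γ (imPart z) * d3Up3 h α β γ (imPart z)
      + h (imPart z) * ∑ μ, ∑ ν, d4Up2 h μ ν μ ν (imPart z) := by
  have hx : imPart z ∈ U := hz
  have h0 := hU.sub_one_ne_zero
  rw [scal_tube hU.isHessianMetric (fun w hw => hU.rMapMetric_eq_fromBlocks hw) hz]
  generalize imPart z = x at hx ⊢
  rw [← hU.sum_inv_mul_quadratic hx, ← hU.sum_inv_mul_quartic hx]
  -- The first term yields -m². The last two yield ((D-2)² - (D-2)(D-3)) m/(D-1) = (D-2) m/(D-1),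
  -- and those with N⁻¹ are the full contractions multiplied by h.
  have e : ∀ i j, (halfHess h x)⁻¹ i j * ∑ l, pderiv i (hessianConn (halfHess h) l l j) x =
      (1 / 2) * m * ((halfHess h x)⁻¹ i j * potentialHess h x i j)
      - h x * ((negHess h x)⁻¹ i j * ∑ ρ, d4Up1 h ρ ρ i j x)
      - h x * ((negHess h x)⁻¹ i j * ∑ α, ∑ β, d3Up1 h α i β x * d3Up1 h β j α x)
      - 1 / (D - 1) * (x i * x j * ∑ ρ, d4Up1 h ρ ρ i j x)
      - 1 / (D - 1) * (x i * x j * ∑ α, ∑ β, d3Up1 h α i β x * d3Up1 h β j α x) := fun i j => by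
    rw [hU.sum_pderiv_hessianConn hx, mul_sub, mul_sub, hU.halfHess_inv_apply hx]
    ring
  simp only [e, Finset.sum_sub_distrib, ← Finset.mul_sum]
  rw [hU.sum_inv_mul_potentialHess hx, hU.sum_mul_mul_quartic hx, hU.sum_mul_mul_quadratic hx]
  field_simp
  ring

/-- The Hermitian matrix is half of `halfHess`, so its inverse is twice the real one; the exchange
of indices is harmless because the inverse is symmetric. -/
theorem kahlerCoeff_inv_apply (hz : z ∈ tubeDomain U) (μ ν : Fin m) :
    (kahlerCoeff (potential h) z)⁻¹ ν μ = ((2 * (halfHess h (imPart z))⁻¹ μ ν : ℝ) : ℂ) := by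
  have hx : imPart z ∈ U := hz
  have h1 : (Matrix.of fun ν μ => ((2 * (halfHess h (imPart z))⁻¹ ν μ : ℝ) : ℂ))
      * kahlerCoeff (potential h) z = 1 := by
    ext i j
    have h2 := congrFun (congrFun
      (Matrix.nonsing_inv_mul _ (hU.halfHess_det_ne_zero hx).isUnit) i) j
    rw [Matrix.mul_apply] at h2 ⊢
    have h3 : ∑ k, 2 * (halfHess h (imPart z))⁻¹ i k * (1 / 4 * potentialHess h (imPart z) k j)
        = (1 : Matrix (Fin m) (Fin m) ℝ) i j := by
      rw [← h2]
      refine Finset.sum_congr rfl fun k _ => ?_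
      rw [halfHess, Matrix.of_apply]
      ring
    simp only [Matrix.of_apply, hU.kahlerCoeff_potential hz, ← Complex.ofReal_mul,
      ← Complex.ofReal_sum, h3, Matrix.one_apply]
    split_ifs <;> simp
  rw [Matrix.inv_eq_left_inv h1, Matrix.of_apply, hU.halfHess_inv_apply hx,
    hU.halfHess_inv_apply hx, hU.negHess_inv_comm hx μ ν, mul_comm (imPart z μ)]

end IsRMapDatum

end RMap

end

/-! ### The main theorem. -/

theorem theorem5p2 (n : ℕ) (D : ℝ) (U : Set (Fin (n + 1) → ℝ)) (h : (Fin (n + 1) → ℝ) → ℝ)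
    (hU : RMap.IsRMapDatum D U h) (z : Fin (n + 1) → ℂ) (hz : z ∈ RMap.tubeDomain U)
    (m : ℝ) (hm : m = (n : ℝ) + 1) (x : Fin (n + 1) → ℝ) (hx : x = RMap.imPart z) :
    -- the objects are well defined: `g_M` is a Riemannian metric and `∂²h` is nondegenerate
    (RMap.rMapMetric h z).PosDef ∧ (RMap.negHess h x).det ≠ 0 ∧
    -- the Riemann tensor
    (∀ ρ σ μ ν : Fin (n + 1),
      RMap.riemannZ (RMap.rMapMetric h) ρ σ μ ν z =
        ((-(1 / (4 * h x ^ 2)) *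
          (-(h x ^ 2) * RMap.d4Up1 h ρ σ μ ν x
            + 1 / (D - 1) * x ρ * (h x * RMap.d3 h σ μ ν x - RMap.d2 h μ σ x * RMap.d1 h ν x)
            + RMap.d1 h μ x * RMap.d1 h ν x * RMap.kdelta ρ σ
            + RMap.d1 h σ x * RMap.d1 h ν x * RMap.kdelta ρ μ
            - h x * (RMap.d2 h σ ν x * RMap.kdelta ρ μ + RMap.d2 h μ ν x * RMap.kdelta ρ σ
                - 1 / (D - 1) * RMap.d2 h μ σ x * RMap.kdelta ρ ν)
            - h x ^ 2 * ∑ β, RMap.d3Up1 h ρ ν β x * RMap.d3Up1 h β σ μ x) : ℝ) : ℂ)) ∧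
    -- the Ricci tensor
    (∀ μ ν : Fin (n + 1),
      RMap.ricciZ (RMap.rMapMetric h) μ ν z =
        -(m : ℂ) * RMap.kahlerCoeff (RMap.potential h) z μ ν
          + ((1 / 4 * ∑ α, ∑ β, RMap.d3Up2 h μ α β x * RMap.d3 h α β ν x
            + 1 / 4 * ∑ ρ, RMap.d4Up1 h ρ ρ μ ν x : ℝ) : ℂ)) ∧
    -- the scalar curvature, as half the trace of the Ricci tensor and as `g^{μν̄} Ric_{μν̄}`
    RMap.scal (RMap.rMapMetric h) z =
      -m ^ 2 + (D - 2) / (D - 1) * m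
        + h x * ∑ α, ∑ β, ∑ γ, RMap.d3 h α β γ x * RMap.d3Up3 h α β γ x
        + h x * ∑ μ, ∑ ν, RMap.d4Up2 h μ ν μ ν x ∧
    (RMap.scal (RMap.rMapMetric h) z : ℂ) =
      ∑ μ, ∑ ν, (RMap.kahlerCoeff (RMap.potential h) z)⁻¹ ν μ
        * RMap.ricciZ (RMap.rMapMetric h) μ ν z := by
  have hm' : m = ((n + 1 : ℕ) : ℝ) := by rw [hm]; push_cast; rfl
  have hM := hU.isHessianMetric
  have hG : ∀ w ∈ RMap.tubeDomain U, RMap.rMapMetric h w = Matrix.fromBlocks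
      (RMap.halfHess h (RMap.imPart w)) 0 0 (RMap.halfHess h (RMap.imPart w)) :=
    fun w hw => hU.rMapMetric_eq_fromBlocks hw
  have hxU : RMap.imPart z ∈ U := hz
  subst hx
  refine ⟨?_, hU.negHess_det_ne_zero hxU, fun ρ σ μ ν => ?_, fun μ ν => ?_, ?_, ?_⟩
  · rw [hG z hz]
    exact RMap.posDef_fromBlocks_self (hU.halfHess_posDef hxU)
  · rw [RMap.riemannZ_tube hM hG hz, hU.pderiv_hessianConn hxU]
    congr 1
    ring
  · rw [RMap.ricciZ_tube hM hG hz, hU.sum_pderiv_hessianConn hxU, hU.sum_d3Up2_mul_d3 hxU,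
      hU.kahlerCoeff_potential hz, hm']
    push_cast
    ring
  · rw [hU.scal_rMapMetric hz, hm']
  · rw [RMap.scal_tube hM hG hz]
    -- The factor 2 of the inverse Hermitian matrix and the -1/2 of the complex Ricci components
    -- combine to the sign in `scal_tube`.
    simp only [hU.kahlerCoeff_inv_apply hz, RMap.ricciZ_tube hM hG hz]
    simp only [← Complex.ofReal_mul, ← Complex.ofReal_sum, ← Finset.sum_neg_distrib]
    congr 1
    exact Finset.sum_congr rfl fun μ _ => Finset.sum_congr rfl fun ν _ => by ring
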